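/- **Setting.** Let $\mathcal T$ be a finite set of tokens with a distinguished token $\mathtt{done}$. Prompts are finite strings of bits and tokens. A language model $\mathsf{Model}$ maps a prompt and the tokens generated so far to a probability distribution on $\mathcal T$; its response $\overline{\mathsf{Model}}(\textsc{prompt})\in\mathcal T^\star$ is obtained by drawing tokens successively until $\mathtt{done}$ is drawn, and its length is always at most a fixed polynomial in $|\textsc{prompt}|$. A watermarking scheme is a triple $\mathcal W=(\mathsf{Setup},\mathsf{Wat},\mathsf{Detect})$, where $\mathsf{Setup}(1^\lambda)$ draws a key $\mathsf{sk}$, the randomized map $\mathsf{Wat}_{\mathsf{sk}}$ sends a prompt to a text in $\mathcal T^\star$ (with fresh randomness on each call), and $\mathsf{Detect}_{\mathsf{sk}}$ sends a text to true or false. A function $\varepsilon(\lambda)$ is negligible if $\lambda^c\varepsilon(\lambda)\to0$ for every $c$. Algorithms are randomized oracle programs; polynomial time means that the number of steps is bounded by a polynomial in the total input length, for all inputs, coins and oracle answers (submitting a query costs its length, receiving the answer costs nothing). $\mathcal W$ is *undetectable* if for every polynomial-time $D$, $$\Bigl|\Pr\bigl[D^{\mathsf{Model},\overline{\mathsf{Model}}}(1^\lambda)\to1\bigr]-\Pr_{\mathsf{sk}\leftarrow\mathsf{Setup}(1^\lambda)}\bigl[D^{\mathsf{Model},\mathsf{Wat}_{\mathsf{sk}}}(1^\lambda)\to1\bigr]\Bigr|$$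 is negligible, where $D$ may query both oracles adaptively with arbitrary prompts, and learns the probabilities output by $\mathsf{Model}$ to any requested number of binary digits. It is *non-uniformly undetectable* if this holds also when $D$ gets an arbitrary additional input $z_\lambda$ of length polynomial in $\lambda$. $\mathsf{Model}$ is *prefix-specifiable* if there is a polynomial-time computable $f$ such that for every prompt $q$ and every text $x=(x_1,\dots,x_k)$ not containing $\mathtt{done}$ that is with positive probability a prefix of $\overline{\mathsf{Model}}(q)$, the response $\overline{\mathsf{Model}}(f(q,x))$ is distributed as $\overline{\mathsf{Model}}(q)$ conditioned on its prefix matching $x$. Here one fixes one of two conventions: the response to $f(q,x)$ is the whole conditioned response, beginning with $x$, or it is only the part after $x$. **Theorem.** Let $\mathsf{Model}$ be prefix-specifiable (under either convention) and let $\mathcal W$ be a watermarking scheme. Then there is a polynomial-time oracle algorithm $\mathcal A$, which gets $1^\lambda$ and a prompt, such that: 1. in every execution, with any oracle that answers prompts by texts in $\mathcal T^\star$, the number of queries made by $\mathcal A$ is exactly the length of the text that it outputs; 2. if $\mathcal W$ is undetectable, then for every prompt $q$, for random $\mathsf{sk}\leftarrow\mathsf{Setup}(1^\lambda)$, the distributions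 $\mathcal A^{\mathsf{Wat}_{\mathsf{sk}}}(1^\lambda,q)$ and $\overline{\mathsf{Model}}(q)$ are negligibly close in statistical distance, even jointly with $\mathsf{sk}$: the statistical distance of $(\mathsf{sk},\mathcal A^{\mathsf{Wat}_{\mathsf{sk}}}(1^\lambda,q))$ and $(\mathsf{sk},\overline{\mathsf{Model}}(q))$ is a negligible function of $\lambda$; 3. if $\mathcal W$ is non-uniformly undetectable, then the same holds for every family of prompts $q_\lambda$ of length polynomial in $\lambda$, in place of the fixed prompt $q$. -/

import Mathlib

noncomputable section

namespace Watermark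

universe u v

/-! ## Randomized oracle programs with a step count -/

/-- Randomized programs over registers `0, 1, 2, …`, each of which holds a string over the
alphabet `Γ`.  The registers are stacks: the head of the string is the top.  Programs may toss fair
coins and query the oracles named by `ι`.  All constants are part of the program text. -/
inductive Prog (Γ : Type u) (ι : Type v) : Type (max u v) where
  /-- do nothing -/
  | skip : Prog Γ ι
  /-- push a fixed symbol -/
  | push (r : ℕ) (a : Γ) : Prog Γ ι
  /-- push a symbol determined by a fair coin: `a` for heads, `b` for tails -/
  | flip (r : ℕ) (a b : Γ) : Prog Γ ι
  /-- remove the top symbol, if there is one -/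
  | pop (r : ℕ) : Prog Γ ι
  /-- overwrite register `dst` by the contents of register `src` -/
  | copy (src dst : ℕ) : Prog Γ ι
  /-- submit the contents of the registers `args` to an oracle; its answer overwrites `dst` -/
  | query (o : ι) (args : List ℕ) (dst : ℕ) : Prog Γ ι
  /-- sequential composition -/
  | seq (p q : Prog Γ ι) : Prog Γ ι
  /-- branch on the top symbol of `r` (`none` if `r` is empty) -/
  | ite (r : ℕ) (test : Option Γ → Bool) (p q : Prog Γ ι) : Prog Γ ι
  /-- repeat `p` as long as the top symbol of `r` passes the test -/
  | while (r : ℕ) (test : Option Γ → Bool) (p : Prog Γ ι) : Prog Γ ι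

/-- A state: the registers, the number of steps so far, and the number of oracle queries so far. -/
@[ext] structure State (Γ : Type u) : Type u where
  regs : ℕ → List Γ
  time : ℕ
  queries : ℕ

namespace State

variable {Γ : Type u}

/-- Charge `n` steps. -/
def tick (s : State Γ) (n : ℕ) : State Γ := { s with time := s.time + n }

/-- Overwrite register `r`. -/
def set (s : State Γ) (r : ℕ) (x : List Γ) : State Γ :=
  { s with regs := Function.update s.regs r x }

/-- Record one oracle query. -/
def countQuery (s : State Γ) : State Γ := { s with queries := s.queries + 1 }

/-- The initial state on the inputs `x` (register `0`) and `y` (register `1`). -/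
def init (x y : List Γ) : State Γ :=
  ⟨fun r => if r = 0 then x else if r = 1 then y else [], 0, 0⟩

/-- The output is the contents of register `0`. -/
def output (s : State Γ) : List Γ := s.regs 0

end State

/-- Randomized oracles: each query is answered with fresh randomness. -/
abbrev Oracles (Γ : Type u) (ι : Type v) := ι → List (List Γ) → PMF (List Γ)

/-- `while test do body`, evaluating the test at most `n` times; `none` if that is not enough.
Each evaluation of the test costs one step. -/
def loop {Γ : Type u} (test : State Γ → Bool) (body : State Γ → PMF (Option (State Γ))) :
    ℕ → State Γ → PMF (Option (State Γ))
  | 0, _ => PMF.pure none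
  | n + 1, s =>
    if test s then
      (body (s.tick 1)).bind fun o => o.elim (PMF.pure none) (loop test body n)
    else PMF.pure (some (s.tick 1))

/-- The law of the final state of a program in which no execution of a loop evaluates its test more
than `n` times (`none` if more is needed).  Every instruction costs one step; copying a string and
submitting strings to an oracle cost their length in addition. -/
def exec {Γ : Type u} {ι : Type v} (O : Oracles Γ ι) (n : ℕ) :
    Prog Γ ι → State Γ → PMF (Option (State Γ))
  | .skip, s => PMF.pure (some (s.tick 1))
  | .push r a, s => PMF.pure (some ((s.set r (a :: s.regs r)).tick 1))
  | .flip r a b, s =>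
    (PMF.uniformOfFintype Bool).bind fun c =>
      PMF.pure (some ((s.set r ((if c then a else b) :: s.regs r)).tick 1))
  | .pop r, s => PMF.pure (some ((s.set r (s.regs r).tail).tick 1))
  | .copy src dst, s =>
    PMF.pure (some ((s.set dst (s.regs src)).tick (1 + (s.regs src).length)))
  | .query o args dst, s =>
    (O o (args.map s.regs)).bind fun ans =>
      PMF.pure (some
        ((s.set dst ans).countQuery.tick (1 + (args.map fun r => (s.regs r).length).sum)))
  | .seq p q, s => (exec O n p s).bind fun o => o.elim (PMF.pure none) (exec O n q)
  | .ite r test p q, s =>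
    if test (s.regs r).head? then exec O n p (s.tick 1) else exec O n q (s.tick 1)
  | .while r test p, s => loop (fun s' => test (s'.regs r).head?) (exec O n p) n s

/-- Polynomial-time programs with two input strings: there is a polynomial `time` such that on all
inputs, whatever the oracles and the coins, the program halts after at most `time (m)` steps, where
`m` is the total length of the inputs.  (Within `B` steps no loop evaluates its test more than
`B + 1` times.) -/
structure PolyTimeProg (Γ : Type u) (ι : Type v) where
  prog : Prog Γ ι
  time : Polynomial ℕ
  halts : ∀ (O : Oracles Γ ι) (x y : List Γ),
    ∀ o ∈ (exec O (time.eval (x.length + y.length) + 1) prog (State.init x y)).support,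
      ∃ s, o = some s ∧ s.time ≤ time.eval (x.length + y.length)

/-- The law of the final state of a polynomial-time program.  (The default value is never used,
because the program halts.) -/
def PolyTimeProg.run {Γ : Type u} {ι : Type v} (A : PolyTimeProg Γ ι) (O : Oracles Γ ι)
    (x y : List Γ) : PMF (State Γ) :=
  (exec O (A.time.eval (x.length + y.length) + 1) A.prog (State.init x y)).map
    fun o => o.getD (State.init x y)

/-! ## Prompts and language models -/

/-- The alphabet of the programs: bits and tokens. -/
abbrev Sym (T : Type u) : Type u := Bool ⊕ T

/-- A prompt is a finite string of bits and tokens. -/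
abbrev Prompt (T : Type u) : Type u := List (Sym T)

/-- The token sequence contained in a string. -/
def tokens {T : Type u} (s : List (Sym T)) : List T := s.filterMap Sum.getRight?

/-- The string that represents a token sequence. -/
def ofTokens {T : Type u} (x : List T) : List (Sym T) := x.map Sum.inr

/-- `1^n` -/
def unary (T : Type u) (n : ℕ) : List (Sym T) := List.replicate n (Sum.inl true)

/-- Starting from the tokens `x`, draw tokens from `next` and append them, until the last token is
`done`, but draw at most `n` tokens. -/
def generate {T : Type u} [DecidableEq T] (done : T) (next : List T → PMF T) :
    ℕ → List T → PMF (List T)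
  | 0, x => PMF.pure x
  | n + 1, x =>
    if x.getLast? = some done then PMF.pure x
    else (next x).bind fun t => generate done next n (x ++ [t])

/-- A language model over the token set `T` with terminating token `done`: it maps a prompt and the
tokens generated so far to a distribution of the next token.  Its responses have length at most
polynomial: the generation has always stopped after `bound (|prompt|)` tokens. -/
structure LanguageModel (T : Type u) [DecidableEq T] (done : T) where
  next : Prompt T → List T → PMF T
  bound : Polynomial ℕ
  terminates : ∀ q : Prompt T,
    ∀ x ∈ (generate done (next q) (bound.eval q.length) []).support, x.getLast? = some done

namespace LanguageModel

variable {T : Type u} [DecidableEq T] {done : T}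

/-- The response of the model to a prompt: tokens are drawn until `done` is drawn.  (The cut-off is
immaterial, because the generation has stopped by then.) -/
def response (M : LanguageModel T done) (q : Prompt T) : PMF (List T) :=
  generate done (M.next q) (M.bound.eval q.length) []

/-- The model is prefix-specifiable: there is a polynomial-time computable `f` such that for every
prompt `q` and every text `x` without `done` that is a prefix of a possible response to `q`, the
response to the prompt `f q x` is distributed as the response to `q` conditioned on its prefix
matching `x`.  If `echo = true`, the response to `f q x` is the whole conditioned response,
beginning with `x`; if `echo = false`, it is the part after `x`. -/
def PrefixSpecifiable (M : LanguageModel T done) (echo : Bool) : Prop :=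
  ∃ (f : Prompt T → List T → Prompt T) (F : PolyTimeProg (Sym T) Empty),
    (∀ q x, ∀ s ∈ (F.run Empty.elim q (ofTokens x)).support, s.output = f q x) ∧
    ∀ (q : Prompt T) (x : List T), done ∉ x →
      ∀ h : ∃ r ∈ {r : List T | x <+: r}, r ∈ (M.response q).support,
        M.response (f q x) =
          ((M.response q).filter {r | x <+: r} h).map
            fun r => if echo then r else r.drop x.length

end LanguageModel

/-! ## Watermarking schemes and undetectability -/

/-- A watermarking scheme over `T` with keys in `K`. -/
structure WatermarkingScheme (T : Type u) (K : Type v) where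
  setup : ℕ → PMF K
  wat : ℕ → K → Prompt T → PMF (List T)
  detect : ℕ → K → List T → Bool

/-- Oracle access to a randomized map from prompts to texts. -/
def textOracle {T : Type u} (w : Prompt T → PMF (List T)) (args : List (List (Sym T))) :
    PMF (List (Sym T)) :=
  (w (args.getD 0 [])).map ofTokens

/-- Oracle access to the distributions output by the model.  A query consists of a prompt, a token
sequence, a token `t` and a precision `k` (in unary); the answer is the integer part of `2 ^ k * p`
in binary, where `p` is the probability that the next token is `t`. -/
def modelOracle {T : Type u} (next : Prompt T → List T → PMF T) (args : List (List (Sym T))) :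
    PMF (List (Sym T)) :=
  match (tokens (args.getD 2 [])).head? with
  | none => PMF.pure []
  | some t => PMF.pure ((Nat.bits
      ⌊2 ^ (args.getD 3 []).length *
        (next (args.getD 0 []) (tokens (args.getD 1 [])) t).toReal⌋₊).map Sum.inl)

/-- The two oracles of a distinguisher. -/
inductive DistOracle where
  | model
  | text

/-- The oracles `next` and `w` of a distinguisher. -/
def distOracles {T : Type u} (next : Prompt T → List T → PMF T) (w : Prompt T → PMF (List T)) :
    Oracles (Sym T) DistOracle
  | .model => modelOracle next
  | .text => textOracle w

/-- The law of the output bit of the distinguisher `D` on input `1^n` and auxiliary input `z`, with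
oracles `next` and `w`; it outputs `1` iff its output string begins with the bit `1`. -/
def decision {T : Type u} (D : PolyTimeProg (Sym T) DistOracle) (n : ℕ) (z : List (Sym T))
    (next : Prompt T → List T → PMF T) (w : Prompt T → PMF (List T)) : PMF Bool :=
  (D.run (distOracles next w) (unary T n) z).map fun s =>
    match s.output.head? with
    | some (Sum.inl true) => true
    | _ => false

/-- Negligible functions of the security parameter: `n ^ c * f n → 0` for every `c`. -/
def Negligible (f : ℕ → ℝ) : Prop :=
  Asymptotics.SuperpolynomialDecay Filter.atTop (fun n : ℕ => (n : ℝ)) f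

/-- Families of strings whose length is polynomial in the security parameter. -/
def PolyLength {Γ : Type u} (z : ℕ → List Γ) : Prop :=
  ∃ P : Polynomial ℕ, ∀ n, (z n).length ≤ P.eval n

/-- Statistical (total variation) distance. -/
def statDist {α : Type u} (μ ν : PMF α) : ℝ := (1 / 2) * ∑' a, |(μ a).toReal - (ν a).toReal|

namespace WatermarkingScheme

variable {T : Type u} {K : Type v} [DecidableEq T] {done : T}

/-- No polynomial-time distinguisher that gets the auxiliary input `z n` tells the model from the
watermarked model with more than negligible advantage.  The key is drawn once, and all queries are
answered with it. -/
def UndetectableWith (W : WatermarkingScheme T K) (M : LanguageModel T done)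
    (z : ℕ → List (Sym T)) : Prop :=
  ∀ D : PolyTimeProg (Sym T) DistOracle, Negligible fun n =>
    |(decision D n (z n) M.next M.response true).toReal -
      ((W.setup n).bind (fun sk => decision D n (z n) M.next (W.wat n sk)) true).toReal|

/-- Undetectability against (uniform) polynomial-time distinguishers. -/
def Undetectable (W : WatermarkingScheme T K) (M : LanguageModel T done) : Prop :=
  W.UndetectableWith M fun _ => []

/-- Undetectability against non-uniform polynomial-time distinguishers, that is, those with an
arbitrary auxiliary input of polynomial length. -/
def NonuniformlyUndetectable (W : WatermarkingScheme T K) (M : LanguageModel T done) : Prop :=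
  ∀ z : ℕ → List (Sym T), PolyLength z → W.UndetectableWith M z

end WatermarkingScheme

/-- An attacker: a polynomial-time program that gets `1^n` and a prompt and has one oracle. -/
abbrev Attacker (T : Type u) := PolyTimeProg (Sym T) Unit

/-- The law of the final state of an attacker with oracle access to `w`. -/
def Attacker.run {T : Type u} (A : Attacker T) (w : Prompt T → PMF (List T)) (n : ℕ)
    (q : Prompt T) : PMF (State (Sym T)) :=
  PolyTimeProg.run A (fun _ => textOracle w) (unary T n) q

/-- The text output by an attacker. -/
def Attacker.text {T : Type u} (A : Attacker T) (w : Prompt T → PMF (List T)) (n : ℕ)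
    (q : Prompt T) : PMF (List T) :=
  (A.run w n q).map fun s => tokens s.output

/-- For random `sk ← Setup(1^n)`, the statistical distance of the attacker's text and the model's
response to `q`, as seen by someone who knows `sk`.  (This is the average over `sk` of the distance
for fixed `sk`, hence at least the distance of the two texts without `sk`.) -/
def attackDist {T : Type u} {K : Type v} [DecidableEq T] {done : T} (A : Attacker T)
    (M : LanguageModel T done) (W : WatermarkingScheme T K) (n : ℕ) (q : Prompt T) : ℝ :=
  statDist
    ((W.setup n).bind fun sk => (A.text (W.wat n sk) n q).map fun y => (sk, y))
    ((W.setup n).bind fun sk => (M.response q).map fun y => (sk, y))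

end Watermark

end

noncomputable section

namespace Watermark

universe u v

/-! ## Auxiliary facts on probability mass functions -/

/-! The attacker builds its text token by token: at the current text `x` it asks its oracle for a
response to `f q x` and keeps only the first new token, so each token of output costs one query. If
the oracle is the model's own response, this token has exactly the law `M.next q x` at every
reachable unfinished text (`LanguageModel.stepLaw_response`). If the oracle is watermarked with a
key `sk`, the token has some law S(x), and it has to be shown that S is close to the model's law p
for most keys, on average over the texts that the attacker itself generates.

Comparing average probabilities of tokens is not enough: the sign of S(x)(t) - p(x)(t) may depend on
the key, and the deviations may cancel. Their squares cannot cancel, and they can be tested: in S² -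
2 S p + p², each product is the probability that two independent draws at the same `x` both yield
`t`, where a draw from S is an oracle query and a draw from p is simulated from the probabilities
that the model oracle reveals. So the second moment of the deviation is a combination of acceptance
probabilities of three polynomial-time distinguishers (`exists_distinguisher`, `deviation_two_eq`).
Without watermark this combination is at most 2^-n, which comes from rounding p to `n` digits
(`deviation_self_le`); undetectability makes it negligible with watermark
(`negligible_keyDeviation`). Jensen's inequality bounds the first moment by the root of the second
(`keyDeviation_one_le`), and a hybrid argument bounds the distance of the texts by the sum of the
first moments over positions and tokens (`l1Dist_generate_le`, `attackDist_le`).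

For a fixed prompt the number of positions does not depend on `n`, and the prompt and the position
are constants of the distinguisher. For a family of prompts, the prompt and the worst position are
the advice.

The programs are verified with `Triple`, a Hoare-style judgement that couples the final state with a
random value of prescribed law and bounds the time for all oracles. -/

theorem bind_congr_support {α : Type*} {β : Type*} {p : PMF α} {f g : α → PMF β}
    (h : ∀ a ∈ p.support, f a = g a) : p.bind f = p.bind g := by
  ext b
  simp only [PMF.bind_apply]
  refine tsum_congr fun a => ?_
  by_cases ha : a ∈ p.support
  · rw [h a ha]
  · rw [PMF.mem_support_iff, not_not] at ha
    simp [ha]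

theorem map_congr_support {α : Type*} {β : Type*} {p : PMF α} {f g : α → β}
    (h : ∀ a ∈ p.support, f a = g a) : p.map f = p.map g :=
  bind_congr_support fun a ha => by simp [h a ha]

/-! ## A program logic -/

section Logic

variable {Γ : Type u} {ι : Type v} {α : Type*} {β : Type*}

namespace State

variable (s : State Γ) (r r' m : ℕ) (x : List Γ)

@[simp] theorem regs_tick : (s.tick m).regs = s.regs := rfl
@[simp] theorem queries_tick : (s.tick m).queries = s.queries := rfl
@[simp] theorem time_tick : (s.tick m).time = s.time + m := rfl
@[simp] theorem queries_set : (s.set r x).queries = s.queries := rfl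
@[simp] theorem time_set : (s.set r x).time = s.time := rfl
@[simp] theorem regs_set : (s.set r x).regs r' = if r' = r then x else s.regs r' := by
  simp [set, Function.update_apply]
@[simp] theorem regs_countQuery : s.countQuery.regs = s.regs := rfl
@[simp] theorem time_countQuery : s.countQuery.time = s.time := rfl

end State

/-- From the state `s`, whenever loops may be iterated at least `B` times, the program `p` halts
within `B` steps, and its final state can be coupled to a random value with law `μ` such that
the relation `R` holds. -/
def Triple (O : Oracles Γ ι) (p : Prog Γ ι) (B : ℕ) (s : State Γ) (μ : PMF α)
    (R : α → State Γ → Prop) : Prop :=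
  ∀ n, B ≤ n → ∃ ν : PMF (α × State Γ), exec O n p s = ν.map (some ∘ Prod.snd) ∧
    ν.map Prod.fst = μ ∧ ∀ x ∈ ν.support, R x.1 x.2 ∧ x.2.time ≤ s.time + B

namespace Triple

variable {O : Oracles Γ ι} {p q : Prog Γ ι} {B B₁ B₂ : ℕ} {s : State Γ} {μ : PMF α}
  {R R' : α → State Γ → Prop} {S : β → State Γ → Prop}

theorem mono (h : Triple O p B₁ s μ R) (hB : B₁ ≤ B₂) (hR : ∀ a s', R a s' → R' a s') :
    Triple O p B₂ s μ R' := by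
  intro n hn
  obtain ⟨ν, h1, h2, h3⟩ := h n (hB.trans hn)
  exact ⟨ν, h1, h2, fun x hx => ⟨hR _ _ (h3 x hx).1, by have := (h3 x hx).2; omega⟩⟩

theorem le (h : Triple O p B₁ s μ R) (hB : B₁ ≤ B₂) : Triple O p B₂ s μ R :=
  h.mono hB fun _ _ => id

theorem post (h : Triple O p B s μ R) (hR : ∀ a s', R a s' → R' a s') : Triple O p B s μ R' :=
  h.mono le_rfl hR

theorem map (h : Triple O p B s μ R) (f : α → β) (hR : ∀ a s', R a s' → S (f a) s') :
    Triple O p B s (μ.map f) S := by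
  intro n hn
  obtain ⟨ν, h1, h2, h3⟩ := h n hn
  refine ⟨ν.map (fun x => (f x.1, x.2)), ?_, ?_, ?_⟩
  · rw [h1, PMF.map_comp]; rfl
  · rw [← h2, PMF.map_comp, PMF.map_comp]; rfl
  · intro x hx
    obtain ⟨y, hy, rfl⟩ := (PMF.mem_support_map_iff _ _ _).1 hx
    exact ⟨hR _ _ (h3 y hy).1, (h3 y hy).2⟩

theorem of_exec_eq (ν : PMF (α × State Γ)) (h1 : ∀ n, exec O n p s = ν.map (some ∘ Prod.snd))
    (h2 : ν.map Prod.fst = μ) (h3 : ∀ x ∈ ν.support, R x.1 x.2 ∧ x.2.time ≤ s.time + B) :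
    Triple O p B s μ R := fun n _ => ⟨ν, h1 n, h2, h3⟩

theorem of_exec_eq_pure {s' : State Γ} {R : Unit → State Γ → Prop}
    (h1 : ∀ n, exec O n p s = PMF.pure (some s')) (hR : R () s') (ht : s'.time ≤ s.time + B) :
    Triple O p B s (PMF.pure ()) R := by
  refine of_exec_eq (PMF.pure ((), s')) (fun n => ?_) ?_ ?_
  · rw [h1, PMF.pure_map]; rfl
  · rw [PMF.pure_map]
  · intro x hx
    rw [PMF.mem_support_pure_iff] at hx
    subst hx
    exact ⟨hR, ht⟩

theorem skip : Triple O .skip 1 s (PMF.pure ()) fun _ s' => s' = s.tick 1 :=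
  of_exec_eq_pure (fun _ => rfl) rfl le_rfl

theorem push (r : ℕ) (a : Γ) :
    Triple O (.push r a) 1 s (PMF.pure ()) fun _ s' => s' = (s.set r (a :: s.regs r)).tick 1 :=
  of_exec_eq_pure (fun _ => rfl) rfl le_rfl

theorem pop (r : ℕ) :
    Triple O (.pop r) 1 s (PMF.pure ()) fun _ s' => s' = (s.set r (s.regs r).tail).tick 1 :=
  of_exec_eq_pure (fun _ => rfl) rfl le_rfl

theorem copy (src dst : ℕ) (hB : 1 + (s.regs src).length ≤ B) :
    Triple O (.copy src dst) B s (PMF.pure ()) fun _ s' =>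
      s' = (s.set dst (s.regs src)).tick (1 + (s.regs src).length) :=
  of_exec_eq_pure (fun _ => rfl) rfl (by simpa using hB)

theorem flip (r : ℕ) (a b : Γ) :
    Triple O (.flip r a b) 1 s (PMF.uniformOfFintype Bool) fun c s' =>
      s' = (s.set r ((if c then a else b) :: s.regs r)).tick 1 := by
  refine of_exec_eq ((PMF.uniformOfFintype Bool).map fun c =>
    (c, (s.set r ((if c then a else b) :: s.regs r)).tick 1)) (fun n => ?_) ?_ ?_
  · rw [PMF.map_comp]; rfl
  · rw [PMF.map_comp]; exact PMF.map_id _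
  · intro x hx
    obtain ⟨y, hy, rfl⟩ := (PMF.mem_support_map_iff _ _ _).1 hx
    exact ⟨rfl, le_rfl⟩

theorem query (o : ι) (args : List ℕ) (dst : ℕ)
    (hB : 1 + (args.map fun r => (s.regs r).length).sum ≤ B) :
    Triple O (.query o args dst) B s (O o (args.map s.regs)) fun ans s' =>
      s'.regs = Function.update s.regs dst ans ∧ s'.queries = s.queries + 1 := by
  refine of_exec_eq ((O o (args.map s.regs)).map fun ans =>
    (ans, ((s.set dst ans).countQuery.tick (1 + (args.map fun r => (s.regs r).length).sum))))
    (fun n => ?_) ?_ ?_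
  · rw [PMF.map_comp]; rfl
  · rw [PMF.map_comp]; exact PMF.map_id _
  · intro x hx
    obtain ⟨y, hy, rfl⟩ := (PMF.mem_support_map_iff _ _ _).1 hx
    exact ⟨⟨rfl, rfl⟩, by simpa using hB⟩

/-- Common core of sequencing and of loop iteration. It speaks of bare distributions and
continuations because the remainder of a loop is not itself a program. -/
theorem bind_aux {μ : PMF α} {f : α → PMF β} {B₁ B₂ : ℕ} {s : State Γ}
    {e : PMF (Option (State Γ))} {k : State Γ → PMF (Option (State Γ))}
    (h : ∃ ν : PMF (α × State Γ), e = ν.map (some ∘ Prod.snd) ∧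
      ν.map Prod.fst = μ ∧ ∀ x ∈ ν.support, R x.1 x.2 ∧ x.2.time ≤ s.time + B₁)
    (h' : ∀ a s', R a s' → ∃ ν : PMF (β × State Γ), k s' = ν.map (some ∘ Prod.snd) ∧
      ν.map Prod.fst = f a ∧ ∀ x ∈ ν.support, S x.1 x.2 ∧ x.2.time ≤ s'.time + B₂) :
    ∃ ν : PMF (β × State Γ),
      (e.bind fun o => o.elim (PMF.pure none) k) = ν.map (some ∘ Prod.snd) ∧
      ν.map Prod.fst = μ.bind f ∧
      ∀ x ∈ ν.support, S x.1 x.2 ∧ x.2.time ≤ s.time + (B₁ + B₂) := by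
  classical
  obtain ⟨ν, rfl, rfl, h3⟩ := h
  have h'' : ∀ x : α × State Γ, ∃ ν₂ : PMF (β × State Γ), x ∈ ν.support →
      k x.2 = ν₂.map (some ∘ Prod.snd) ∧ ν₂.map Prod.fst = f x.1 ∧
      ∀ y ∈ ν₂.support, S y.1 y.2 ∧ y.2.time ≤ x.2.time + B₂ := by
    intro x
    by_cases hx : x ∈ ν.support
    · obtain ⟨ν₂, h⟩ := h' x.1 x.2 (h3 x hx).1
      exact ⟨ν₂, fun _ => h⟩
    -- Off the support the value is arbitrary; any law of the right type serves as default for the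
    -- choice.
    · exact ⟨(f x.1).map fun b => (b, x.2), fun h => absurd h hx⟩
  choose N hN using h''
  refine ⟨ν.bind N, ?_, ?_, ?_⟩
  · rw [PMF.bind_map, PMF.map_bind]
    exact bind_congr_support fun x hx => (hN x hx).1
  · rw [PMF.bind_map, PMF.map_bind]
    exact bind_congr_support fun x hx => (hN x hx).2.1
  · intro y hy
    obtain ⟨x, hx, hy⟩ := (PMF.mem_support_bind_iff _ _ _).1 hy
    have h1 := (hN x hx).2.2 y hy
    have h2 := (h3 x hx).2
    exact ⟨h1.1, by omega⟩

theorem seq {f : α → PMF β} (h : Triple O p B₁ s μ R)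
    (h' : ∀ a s', R a s' → Triple O q B₂ s' (f a) S) :
    Triple O (.seq p q) (B₁ + B₂) s (μ.bind f) S := fun n hn =>
  bind_aux (h n (by omega)) fun a s' hR => h' a s' hR n (by omega)

theorem seq_det {R : Unit → State Γ → Prop} {μ : PMF β} (h : Triple O p B₁ s (PMF.pure ()) R)
    (h' : ∀ s', R () s' → Triple O q B₂ s' μ S) :
    Triple O (.seq p q) (B₁ + B₂) s μ S := by
  have := seq (f := fun _ => μ) h fun _ s' => h' s'
  rwa [PMF.bind_const] at this

theorem of_unit {R : Unit → State Γ → Prop} (h : Triple O p B s (PMF.pure ()) R) (b : β)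
    (hS : ∀ s', R () s' → S b s') : Triple O p B s (PMF.pure b) S := by
  have := h.map (fun _ => b) (S := S) fun _ s' => hS s'
  rwa [PMF.pure_map] at this

theorem seq_map {g : α → β} (h : Triple O p B₁ s μ R)
    (h' : ∀ a s', R a s' → Triple O q B₂ s' (PMF.pure ()) fun _ => S (g a)) :
    Triple O (.seq p q) (B₁ + B₂) s (μ.map g) S :=
  seq (f := fun a => PMF.pure (g a)) h fun a s' hR => (h' a s' hR).of_unit _ fun _ => id

theorem ite {r : ℕ} {test : Option Γ → Bool}
    (h₁ : test (s.regs r).head? = true → Triple O p B (s.tick 1) μ R)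
    (h₂ : test (s.regs r).head? = false → Triple O q B (s.tick 1) μ R) :
    Triple O (.ite r test p q) (1 + B) s μ R := by
  intro n hn
  cases ht : test (s.regs r).head?
  · obtain ⟨ν, h1, h2, h3⟩ := h₂ ht n (by omega)
    refine ⟨ν, by simp [exec, ht, h1], h2, fun x hx => ⟨(h3 x hx).1, ?_⟩⟩
    have := (h3 x hx).2
    rw [State.time_tick] at this
    omega
  · obtain ⟨ν, h1, h2, h3⟩ := h₁ ht n (by omega)
    refine ⟨ν, by simp [exec, ht, h1], h2, fun x hx => ⟨(h3 x hx).1, ?_⟩⟩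
    have := (h3 x hx).2
    rw [State.time_tick] at this
    omega

/-- Iterate `f` at most `k` times, stopping when `halted` holds. -/
def _root_.Watermark.iterUntil (f : α → PMF α) (halted : α → Bool) : ℕ → α → PMF α
  | 0, a => PMF.pure a
  | k + 1, a => if halted a then PMF.pure a else (f a).bind (iterUntil f halted k)

/-- The invariant is indexed by the number of iterations still allowed, which must be visible in the
tested register. Each iteration costs one test and the body, and the final failing test accounts for
the extra step. -/
theorem while_loop {r : ℕ} {test : Option Γ → Bool} {f : α → PMF α} {halted : α → Bool}
    {Inv : ℕ → α → State Γ → Prop}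
    (htest : ∀ k a s, Inv k a s → (test (s.regs r).head? = true ↔ k ≠ 0 ∧ halted a = false))
    (hbody : ∀ k a s, Inv (k + 1) a s → halted a = false →
      Triple O p B (s.tick 1) (f a) (Inv k))
    (hpost : ∀ k a s, Inv k a s → (k = 0 ∨ halted a = true) → R a (s.tick 1))
    (k : ℕ) (a : α) (s : State Γ) (hs : Inv k a s) :
    Triple O (.while r test p) (k * (B + 1) + 1) s (iterUntil f halted k a) R := by
  intro n hn
  -- The fuel `n` inside the body stays fixed, while the fuel `m` of the loop itself decreases with
  -- each iteration.
  have key : ∀ (k m : ℕ) (a : α) (s : State Γ), k + 1 ≤ m → k * (B + 1) + 1 ≤ n → Inv k a s →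
      ∃ ν : PMF (α × State Γ), loop (fun s' => test (s'.regs r).head?) (exec O n p) m s =
        ν.map (some ∘ Prod.snd) ∧ ν.map Prod.fst = iterUntil f halted k a ∧
        ∀ x ∈ ν.support, R x.1 x.2 ∧ x.2.time ≤ s.time + (k * (B + 1) + 1) := by
    intro k
    induction k with
    | zero =>
      intro m a s hm _ hs
      obtain ⟨m, rfl⟩ : ∃ m', m = m' + 1 := ⟨m - 1, by omega⟩
      have ht : test (s.regs r).head? = false := by
        have := htest 0 a s hs
        simpa using this
      refine ⟨PMF.pure (a, s.tick 1), ?_, ?_, ?_⟩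
      · simp [loop, ht, PMF.pure_map]
      · simp [iterUntil, PMF.pure_map]
      · intro x hx
        rw [PMF.mem_support_pure_iff] at hx
        subst hx
        exact ⟨hpost 0 a s hs (Or.inl rfl), by simp⟩
    | succ k ih =>
      intro m a s hm hn hs
      obtain ⟨m, rfl⟩ : ∃ m', m = m' + 1 := ⟨m - 1, by omega⟩
      rw [add_mul] at hn
      cases hhalted : halted a
      · have ht : test (s.regs r).head? = true := (htest _ a s hs).2 ⟨by omega, hhalted⟩
        have := bind_aux (S := R) (B₂ := k * (B + 1) + 1) (f := iterUntil f halted k)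
          (k := loop (fun s' => test (s'.regs r).head?) (exec O n p) m)
          (hbody k a s hs hhalted n (by omega)) fun a' s' h => ih m a' s' (by omega) (by omega) h
        obtain ⟨ν, h1, h2, h3⟩ := this
        refine ⟨ν, ?_, ?_, fun x hx => ⟨(h3 x hx).1, ?_⟩⟩
        · simp only [loop, ht, if_true]; exact h1
        · simp only [iterUntil, hhalted]; exact h2
        · have := (h3 x hx).2
          rw [State.time_tick] at this
          rw [add_mul]
          omega
      · have ht : test (s.regs r).head? = false := by
          have := htest _ a s hs
          rw [hhalted] at this
          simpa using this
        refine ⟨PMF.pure (a, s.tick 1), ?_, ?_, ?_⟩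
        · simp [loop, ht, PMF.pure_map]
        · simp [iterUntil, PMF.pure_map, hhalted]
        · intro x hx
          rw [PMF.mem_support_pure_iff] at hx
          subst hx
          refine ⟨hpost _ a s hs (Or.inr hhalted), ?_⟩
          simp
  have h1 : k ≤ k * (B + 1) := Nat.le_mul_of_pos_right _ (by omega)
  exact key k n a s (by omega) hn hs

theorem while_det {r : ℕ} {test : Option Γ → Bool} {R : State Γ → Prop}
    {Inv : ℕ → State Γ → Prop}
    (htest : ∀ k s, Inv k s → (test (s.regs r).head? = true ↔ k ≠ 0))
    (hbody : ∀ k s, Inv (k + 1) s → Triple O p B (s.tick 1) (PMF.pure ()) fun _ => Inv k)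
    (hpost : ∀ s, Inv 0 s → R (s.tick 1))
    (k : ℕ) (s : State Γ) (hs : Inv k s) :
    Triple O (.while r test p) (k * (B + 1) + 1) s (PMF.pure ()) fun _ => R := by
  have := while_loop (O := O) (p := p) (f := PMF.pure) (halted := fun _ : Unit => false)
    (Inv := fun k _ => Inv k) (r := r) (test := test) (B := B) (R := fun _ => R)
    (fun k _ s hs => by simpa using htest k s hs)
    (fun k _ s hs _ => hbody k s hs)
    (fun k _ s hs hk => by
      have : k = 0 := by simpa using hk
      subst this
      exact hpost s hs) k () s hs
  have e : ∀ k, iterUntil PMF.pure (fun _ : Unit => false) k () = PMF.pure () := by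
    intro k
    induction k with
    | zero => rfl
    | succ k ih => simp [iterUntil, PMF.pure_bind, ih]
  rwa [e] at this

end Triple

/-! ## Polynomial bounds and packaging -/

/-- Bounded by a polynomial. -/
def PolyBounded (g : ℕ → ℕ) : Prop := ∃ P : Polynomial ℕ, ∀ m, g m ≤ P.eval m

theorem _root_.Polynomial.eval_le_eval_of_le (P : Polynomial ℕ) {a b : ℕ} (h : a ≤ b) :
    P.eval a ≤ P.eval b := by
  simp only [Polynomial.eval_eq_sum_range]
  gcongr

namespace PolyBounded

variable {g h : ℕ → ℕ}

theorem eval (P : Polynomial ℕ) : PolyBounded fun m => P.eval m := ⟨P, fun _ => le_rfl⟩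

theorem const (c : ℕ) : PolyBounded fun _ => c := ⟨Polynomial.C c, by simp⟩

theorem id : PolyBounded fun m => m := ⟨Polynomial.X, by simp⟩

theorem add (hg : PolyBounded g) (hh : PolyBounded h) : PolyBounded fun m => g m + h m := by
  obtain ⟨P, hP⟩ := hg
  obtain ⟨Q, hQ⟩ := hh
  exact ⟨P + Q, fun m => by simpa using add_le_add (hP m) (hQ m)⟩

theorem mul (hg : PolyBounded g) (hh : PolyBounded h) : PolyBounded fun m => g m * h m := by
  obtain ⟨P, hP⟩ := hg
  obtain ⟨Q, hQ⟩ := hh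
  exact ⟨P * Q, fun m => by simpa using mul_le_mul' (hP m) (hQ m)⟩

theorem pow (hg : PolyBounded g) (d : ℕ) : PolyBounded fun m => g m ^ d := by
  obtain ⟨P, hP⟩ := hg
  exact ⟨P ^ d, fun m => by simpa using Nat.pow_le_pow_left (hP m) d⟩

theorem comp (hg : PolyBounded g) (hh : PolyBounded h) : PolyBounded fun m => g (h m) := by
  obtain ⟨P, hP⟩ := hg
  obtain ⟨Q, hQ⟩ := hh
  exact ⟨P.comp Q, fun m => by
    simpa using (hP _).trans (P.eval_le_eval_of_le (hQ m))⟩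

end PolyBounded

/-- A polynomial that dominates the time bound also provides enough fuel, so the execution never
ends in `none` and the coupling passes to `run`. -/
theorem exists_polyTimeProg (p : Prog Γ ι) {B : ℕ → ℕ} (hB : PolyBounded B)
    {μ : Oracles Γ ι → List Γ → List Γ → PMF α}
    {R : Oracles Γ ι → List Γ → List Γ → α → State Γ → Prop}
    (h : ∀ O x y, Triple O p (B (x.length + y.length)) (State.init x y) (μ O x y) (R O x y)) :
    ∃ A : PolyTimeProg Γ ι, ∀ O x y, ∃ ν : PMF (α × State Γ), A.run O x y = ν.map Prod.snd ∧
      ν.map Prod.fst = μ O x y ∧ ∀ z ∈ ν.support, R O x y z.1 z.2 := by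
  obtain ⟨P, hP⟩ := hB
  have key : ∀ O x y, ∃ ν : PMF (α × State Γ),
      exec O (P.eval (x.length + y.length) + 1) p (State.init x y) = ν.map (some ∘ Prod.snd) ∧
      ν.map Prod.fst = μ O x y ∧ ∀ z ∈ ν.support, R O x y z.1 z.2 ∧
        z.2.time ≤ P.eval (x.length + y.length) := by
    intro O x y
    have h1 := hP (x.length + y.length)
    obtain ⟨ν, h2, h3, h4⟩ := h O x y (P.eval (x.length + y.length) + 1) (by omega)
    refine ⟨ν, h2, h3, fun z hz => ⟨(h4 z hz).1, ?_⟩⟩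
    have h5 := (h4 z hz).2
    have h6 : (State.init x y).time = 0 := rfl
    omega
  refine ⟨⟨p, P, ?_⟩, ?_⟩
  · intro O x y o ho
    obtain ⟨ν, h1, -, h3⟩ := key O x y
    rw [h1] at ho
    obtain ⟨z, hz, rfl⟩ := (PMF.mem_support_map_iff _ _ _).1 ho
    exact ⟨z.2, rfl, (h3 z hz).2⟩
  · intro O x y
    obtain ⟨ν, h1, h2, h3⟩ := key O x y
    refine ⟨ν, ?_, h2, fun z hz => (h3 z hz).1⟩
    simp only [PolyTimeProg.run, h1, PMF.map_comp]
    rfl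

/-! ## Embedding a program without oracles as a subroutine -/

namespace Prog

/-- Shift all registers by `k`. -/
def lift (ι : Type v) (k : ℕ) : Prog Γ Empty → Prog Γ ι
  | .skip => .skip
  | .push r a => .push (r + k) a
  | .flip r a b => .flip (r + k) a b
  | .pop r => .pop (r + k)
  | .copy src dst => .copy (src + k) (dst + k)
  | .query o _ _ => o.elim
  | .seq p q => .seq (p.lift ι k) (q.lift ι k)
  | .ite r test p q => .ite (r + k) test (p.lift ι k) (q.lift ι k)
  | .while r test p => .while (r + k) test (p.lift ι k)

/-- A strict upper bound of the registers written by the program. -/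
def width : Prog Γ ι → ℕ
  | .skip => 0
  | .push r _ => r + 1
  | .flip r _ _ => r + 1
  | .pop r => r + 1
  | .copy _ dst => dst + 1
  | .query _ _ dst => dst + 1
  | .seq p q => max p.width q.width
  | .ite _ _ p q => max p.width q.width
  | .while _ _ p => p.width

end Prog

/-- This keeps the registers above the work space of a subroutine empty, so that clearing finitely
many registers prepares the next call. -/
theorem exec_frame (O : Oracles Γ ι) (n : ℕ) (p : Prog Γ ι) : ∀ (s s' : State Γ),
    some s' ∈ (exec O n p s).support → ∀ r, p.width ≤ r → s'.regs r = s.regs r := by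
  induction p with
  | skip =>
    intro s s' h r hr
    simp only [exec, PMF.mem_support_pure_iff, Option.some.injEq] at h
    simp [h]
  | push r₀ a =>
    intro s s' h r hr
    simp only [exec, PMF.mem_support_pure_iff, Option.some.injEq] at h
    simp only [Prog.width] at hr
    simp [h, show r ≠ r₀ by omega]
  | flip r₀ a b =>
    intro s s' h r hr
    simp only [exec, PMF.mem_support_bind_iff, PMF.mem_support_pure_iff, Option.some.injEq] at h
    obtain ⟨c, -, h⟩ := h
    simp only [Prog.width] at hr
    simp [h, show r ≠ r₀ by omega]
  | pop r₀ =>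
    intro s s' h r hr
    simp only [exec, PMF.mem_support_pure_iff, Option.some.injEq] at h
    simp only [Prog.width] at hr
    simp [h, show r ≠ r₀ by omega]
  | copy src dst =>
    intro s s' h r hr
    simp only [exec, PMF.mem_support_pure_iff, Option.some.injEq] at h
    simp only [Prog.width] at hr
    simp [h, show r ≠ dst by omega]
  | query o args dst =>
    intro s s' h r hr
    simp only [exec, PMF.mem_support_bind_iff, PMF.mem_support_pure_iff, Option.some.injEq] at h
    obtain ⟨c, -, h⟩ := h
    simp only [Prog.width] at hr
    simp [h, show r ≠ dst by omega]
  | seq p q ihp ihq =>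
    intro s s' h r hr
    simp only [Prog.width, max_le_iff] at hr
    simp only [exec, PMF.mem_support_bind_iff] at h
    obtain ⟨o, ho, h⟩ := h
    cases o with
    | none => simp at h
    | some s₁ => rw [ihq _ _ h r hr.2, ihp _ _ ho r hr.1]
  | ite r₀ test p q ihp ihq =>
    intro s s' h r hr
    simp only [Prog.width, max_le_iff] at hr
    simp only [exec] at h
    split at h
    · rw [ihp _ _ h r hr.1]; rfl
    · rw [ihq _ _ h r hr.2]; rfl
  | _ r₀ test p ih =>
    intro s s' h r hr
    simp only [Prog.width] at hr
    simp only [exec] at h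
    have key : ∀ (m : ℕ) (s : State Γ), some s' ∈ (loop (fun s' => test (s'.regs r₀).head?)
        (exec O n p) m s).support → s'.regs r = s.regs r := by
      intro m
      induction m with
      | zero => intro s h; simp [loop] at h
      | succ m ihm =>
        intro s h
        simp only [loop] at h
        split at h
        · simp only [PMF.mem_support_bind_iff] at h
          obtain ⟨o, ho, h⟩ := h
          cases o with
          | none => simp at h
          | some s₁ => rw [ihm _ h, ih _ _ ho r hr]; rfl
        · simp only [PMF.mem_support_pure_iff, Option.some.injEq] at h
          rw [h]; rfl
    exact key n s h

/-- The state `s`, with the registers shifted by `k`, the registers below `k` as in `g`, the time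
shifted by `t`, and with `c` queries. -/
def State.embed (k : ℕ) (g : ℕ → List Γ) (t c : ℕ) (s : State Γ) : State Γ :=
  ⟨fun r => if r < k then g r else s.regs (r - k), s.time + t, c⟩

section

variable (k : ℕ) (g : ℕ → List Γ) (t c : ℕ) (s : State Γ)

theorem State.embed_regs_add (r : ℕ) : (s.embed k g t c).regs (r + k) = s.regs r := by
  simp [embed]

theorem State.embed_tick (m : ℕ) : (s.embed k g t c).tick m = (s.tick m).embed k g t c := by
  ext1
  · rfl
  · simp only [embed, tick]; omega
  · rfl

theorem State.embed_set (r : ℕ) (x : List Γ) :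
    (s.embed k g t c).set (r + k) x = (s.set r x).embed k g t c := by
  ext1
  · funext r'
    simp only [embed, set, Function.update_apply]
    by_cases h : r' = r + k
    · simp [h]
    · by_cases h' : r' < k
      · simp [h, h']
      · simp [h, h', show r' - k ≠ r by omega]
  · rfl
  · rfl

end

/-- Programs without queries see only the shifted registers: the lower registers, the time offset
and the query count are carried along unchanged. -/
theorem exec_lift (O : Oracles Γ ι) (n k : ℕ) (g : ℕ → List Γ) (t c : ℕ) (p : Prog Γ Empty) :
    ∀ s : State Γ, exec O n (p.lift ι k) (s.embed k g t c) =
      (exec Empty.elim n p s).map (Option.map (State.embed k g t c)) := by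
  -- The embedding commutes with sequential composition; this serves both `seq` and the iterations
  -- of a loop.
  have e : ∀ (P : PMF (Option (State Γ))) (K K' : State Γ → PMF (Option (State Γ)))
      (_ : ∀ s, K (s.embed k g t c) = (K' s).map (Option.map (State.embed k g t c))),
      ((P.map (Option.map (State.embed k g t c))).bind fun o => o.elim (PMF.pure none) K) =
      (P.bind fun o => o.elim (PMF.pure none) K').map (Option.map (State.embed k g t c)) := by
    intro P K K' h
    rw [PMF.bind_map, PMF.map_bind]
    congr 1
    funext o
    cases o with
    | none => simp [PMF.pure_map]
    | some s => exact h s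
  induction p with
  | skip => intro s; simp [exec, Prog.lift, PMF.pure_map, State.embed_tick]
  | push r a =>
    intro s
    simp [exec, Prog.lift, PMF.pure_map, State.embed_tick, State.embed_set, State.embed_regs_add]
  | flip r a b =>
    intro s
    simp [exec, Prog.lift, PMF.pure_map, PMF.map_bind, State.embed_tick, State.embed_set,
      State.embed_regs_add]
  | pop r =>
    intro s
    simp [exec, Prog.lift, PMF.pure_map, State.embed_tick, State.embed_set, State.embed_regs_add]
  | copy src dst =>
    intro s
    simp [exec, Prog.lift, PMF.pure_map, State.embed_tick, State.embed_set, State.embed_regs_add]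
  | query o args dst => exact o.elim
  | seq p q ihp ihq =>
    intro s
    simp only [exec, Prog.lift, ihp]
    exact e _ _ _ ihq
  | ite r test p q ihp ihq =>
    intro s
    simp only [exec, Prog.lift, State.embed_regs_add, State.embed_tick, ihp, ihq]
    split <;> rfl
  | _ r test p ih =>
    intro s
    simp only [exec, Prog.lift]
    have key : ∀ (m : ℕ) (s : State Γ), loop (fun s' => test (s'.regs (r + k)).head?)
        (exec O n (p.lift ι k)) m (s.embed k g t c) =
        (loop (fun s' => test (s'.regs r).head?) (exec Empty.elim n p) m s).map
          (Option.map (State.embed k g t c)) := by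
      intro m
      induction m with
      | zero => intro s; simp [loop, PMF.pure_map]
      | succ m ihm =>
        intro s
        simp only [loop, State.embed_regs_add, State.embed_tick, ih]
        split
        · exact e _ _ _ ihm
        · simp [PMF.pure_map]
    exact key n s

/-- More fuel does not change an execution that halts. -/
theorem exec_mono (O : Oracles Γ ι) {n n' : ℕ} (hn : n ≤ n') (p : Prog Γ ι) : ∀ s : State Γ,
    none ∉ (exec O n p s).support → exec O n' p s = exec O n p s := by
  have e : ∀ (P : PMF (Option (State Γ))) (K K' : State Γ → PMF (Option (State Γ)))
      (_ : ∀ s, none ∉ (K s).support → K' s = K s),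
      none ∉ (P.bind fun o => o.elim (PMF.pure none) K).support → none ∉ P.support ∧
      (P.bind fun o => o.elim (PMF.pure none) K') =
      (P.bind fun o => o.elim (PMF.pure none) K) := by
    intro P K K' h h'
    simp only [PMF.mem_support_bind_iff, not_exists, not_and] at h'
    refine ⟨fun h0 => h' none h0 (by simp), bind_congr_support fun o ho => ?_⟩
    cases o with
    | none => rfl
    | some s => exact h s (h' _ ho)
  induction p with
  | skip => intro s _; rfl
  | push r a => intro s _; rfl
  | flip r a b => intro s _; rfl
  | pop r => intro s _; rfl
  | copy src dst => intro s _; rfl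
  | query o args dst => intro s _; rfl
  | seq p q ihp ihq =>
    intro s h
    simp only [exec] at h ⊢
    obtain ⟨h1, h2⟩ := e _ _ _ ihq h
    rw [ihp _ h1, h2]
  | ite r test p q ihp ihq =>
    intro s h
    simp only [exec] at h ⊢
    split
    · rename_i ht
      rw [if_pos ht] at h
      exact ihp _ h
    · rename_i ht
      rw [if_neg ht] at h
      exact ihq _ h
  | _ r test p ih =>
    intro s h
    simp only [exec] at h ⊢
    have key : ∀ (m m' : ℕ) (s : State Γ), m ≤ m' →
        none ∉ (loop (fun s' => test (s'.regs r).head?) (exec O n p) m s).support →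
        loop (fun s' => test (s'.regs r).head?) (exec O n' p) m' s =
        loop (fun s' => test (s'.regs r).head?) (exec O n p) m s := by
      intro m
      induction m with
      | zero => intro m' s _ h; simp [loop] at h
      | succ m ihm =>
        intro m' s hm h
        obtain ⟨m', rfl⟩ : ∃ m'', m' = m'' + 1 := ⟨m' - 1, by omega⟩
        simp only [loop] at h ⊢
        split
        · rename_i ht
          rw [if_pos ht] at h
          obtain ⟨h1, h2⟩ := e _ _ _ (fun s => ihm m' s (by omega)) h
          rw [ih _ h1, h2]
        · rfl
    exact key n n' s hn h

/-- A subroutine call: the caller's fuel may exceed that of `F`, which is harmless by `exec_mono`.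
The `max 2` accounts for the two input registers, which may lie above everything that `F` writes. -/
theorem Triple.lift {F : PolyTimeProg Γ Empty} {q x y : List Γ} {k : ℕ} {O : Oracles Γ ι}
    (hF : ∀ s ∈ (F.run Empty.elim q x).support, s.output = y) {s : State Γ}
    (h0 : s.regs k = q) (h1 : s.regs (k + 1) = x) (h2 : ∀ r, k + 2 ≤ r → s.regs r = []) :
    Triple O (F.prog.lift ι k) (F.time.eval (q.length + x.length) + 1) s (PMF.pure ())
      fun _ s' => s'.regs k = y ∧ (∀ r, r < k → s'.regs r = s.regs r) ∧
        (∀ r, k + max 2 F.prog.width ≤ r → s'.regs r = []) ∧ s'.queries = s.queries := by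
  intro n hn
  have hs : s = (State.init q x).embed k s.regs s.time s.queries := by
    ext1
    · funext r
      simp only [State.embed, State.init]
      by_cases h : r < k
      · simp [h]
      · by_cases h' : r = k
        · simp [h', h0]
        · by_cases h'' : r = k + 1
          · simp [h'', h1]
          · rw [if_neg h, if_neg (by omega), if_neg (by omega), h2 r (by omega)]
    · simp [State.embed, State.init]
    · simp [State.embed]
  set N := F.time.eval (q.length + x.length) + 1
  have hh := F.halts Empty.elim q x
  -- Halting excludes `none`, which is what allows the fuel to be raised to `n`.
  have hnone : none ∉ (exec Empty.elim N F.prog (State.init q x)).support := by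
    intro h
    obtain ⟨s', h, -⟩ := hh _ h
    cases h
  have he : exec O n (F.prog.lift ι k) s = (exec Empty.elim N F.prog (State.init q x)).map
      (Option.map (State.embed k s.regs s.time s.queries)) := by
    conv_lhs => rw [hs]
    rw [exec_lift, exec_mono _ hn _ _ hnone]
  refine ⟨(F.run Empty.elim q x).map fun s' => ((), s'.embed k s.regs s.time s.queries), ?_, ?_, ?_⟩
  · rw [he, PolyTimeProg.run, PMF.map_comp, PMF.map_comp]
    refine map_congr_support fun o ho => ?_
    obtain ⟨s', rfl, -⟩ := hh o ho
    rfl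
  · rw [PMF.map_comp]
    exact PMF.map_const _ _
  · intro z hz
    obtain ⟨s', hs', rfl⟩ := (PMF.mem_support_map_iff _ _ _).1 hz
    have hy := hF s' hs'
    rw [PolyTimeProg.run] at hs'
    obtain ⟨o, ho, rfl⟩ := (PMF.mem_support_map_iff _ _ _).1 hs'
    obtain ⟨s', rfl, ht⟩ := hh o ho
    have hf := exec_frame _ _ _ _ _ ho
    refine ⟨⟨?_, ?_, ?_, rfl⟩, ?_⟩
    · simpa [State.embed, State.output] using hy
    · intro r hr
      simp [State.embed, hr]
    · intro r hr
      have h3 : 2 ≤ r - k := by have := le_max_left 2 F.prog.width; omega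
      have h4 : F.prog.width ≤ r - k := by have := le_max_right 2 F.prog.width; omega
      simp only [State.embed, Option.getD_some]
      rw [if_neg (by omega), hf _ h4]
      simp only [State.init]
      rw [if_neg (by omega), if_neg (by omega)]
    · simp only [State.embed, Option.getD_some, N]
      omega

end Logic

/-- Without oracles, a register grows by at most one symbol per step. -/
theorem exec_length_le {Γ : Type u} (n C : ℕ) (p : Prog Γ Empty) : ∀ (s s' : State Γ),
    some s' ∈ (exec Empty.elim n p s).support → (∀ r, (s.regs r).length ≤ s.time + C) →
    ∀ r, (s'.regs r).length ≤ s'.time + C := by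
  induction p with
  | skip =>
    intro s s' h hs r
    simp only [exec, PMF.mem_support_pure_iff, Option.some.injEq] at h
    have := hs r
    simp only [h, State.regs_tick, State.time_tick]
    omega
  | push r₀ a =>
    intro s s' h hs r
    simp only [exec, PMF.mem_support_pure_iff, Option.some.injEq] at h
    have := hs r
    have := hs r₀
    simp only [h, State.regs_tick, State.time_tick, State.regs_set, State.time_set]
    split <;> simp <;> omega
  | flip r₀ a b =>
    intro s s' h hs r
    simp only [exec, PMF.mem_support_bind_iff, PMF.mem_support_pure_iff, Option.some.injEq] at h
    obtain ⟨c, -, h⟩ := h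
    have := hs r
    have := hs r₀
    simp only [h, State.regs_tick, State.time_tick, State.regs_set, State.time_set]
    split <;> simp <;> omega
  | pop r₀ =>
    intro s s' h hs r
    simp only [exec, PMF.mem_support_pure_iff, Option.some.injEq] at h
    have := hs r
    have := hs r₀
    simp only [h, State.regs_tick, State.time_tick, State.regs_set, State.time_set]
    split <;> simp <;> omega
  | copy src dst =>
    intro s s' h hs r
    simp only [exec, PMF.mem_support_pure_iff, Option.some.injEq] at h
    have := hs r
    have := hs src
    simp only [h, State.regs_tick, State.time_tick, State.regs_set, State.time_set]
    split <;> omega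
  | query o args dst => exact o.elim
  | seq p q ihp ihq =>
    intro s s' h hs
    simp only [exec, PMF.mem_support_bind_iff] at h
    obtain ⟨o, ho, h⟩ := h
    cases o with
    | none => simp at h
    | some s₁ => exact ihq _ _ h (ihp _ _ ho hs)
  | ite r₀ test p q ihp ihq =>
    intro s s' h hs
    have hs' : ∀ r, ((s.tick 1).regs r).length ≤ (s.tick 1).time + C := fun r => by
      have := hs r
      simp only [State.regs_tick, State.time_tick]
      omega
    simp only [exec] at h
    split at h
    · exact ihp _ _ h hs'
    · exact ihq _ _ h hs'
  | _ r₀ test p ih =>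
    intro s s' h hs
    simp only [exec] at h
    have key : ∀ (m : ℕ) (s : State Γ), some s' ∈ (loop (fun s' => test (s'.regs r₀).head?)
        (exec Empty.elim n p) m s).support → (∀ r, (s.regs r).length ≤ s.time + C) →
        ∀ r, (s'.regs r).length ≤ s'.time + C := by
      intro m
      induction m with
      | zero => intro s h; simp [loop] at h
      | succ m ihm =>
        intro s h hs
        have hs' : ∀ r, ((s.tick 1).regs r).length ≤ (s.tick 1).time + C := fun r => by
          have := hs r
          simp only [State.regs_tick, State.time_tick]
          omega
        simp only [loop] at h
        split at h
        · simp only [PMF.mem_support_bind_iff] at h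
          obtain ⟨o, ho, h⟩ := h
          cases o with
          | none => simp at h
          | some s₁ => exact ihm _ h (ih _ _ ho hs')
        · simp only [PMF.mem_support_pure_iff, Option.some.injEq] at h
          rw [h]; exact hs'
    exact key n s h hs

/-- The output becomes a query, whose cost is its length; hence it must be polynomially bounded. -/
theorem PolyTimeProg.length_output_le {Γ : Type u} {F : PolyTimeProg Γ Empty} {q x y : List Γ}
    (hF : ∀ s ∈ (F.run Empty.elim q x).support, s.output = y) :
    y.length ≤ F.time.eval (q.length + x.length) + (q.length + x.length) := by
  obtain ⟨o, ho⟩ := (exec Empty.elim (F.time.eval (q.length + x.length) + 1) F.prog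
    (State.init q x)).support_nonempty
  obtain ⟨s, rfl, ht⟩ := F.halts _ _ _ o ho
  have hs := hF s ((PMF.mem_support_map_iff _ _ _).2 ⟨_, ho, rfl⟩)
  have := exec_length_le _ (q.length + x.length) _ _ _ ho (fun r => by
    simp only [State.init]
    split
    · omega
    · split
      · omega
      · simp) 0
  rw [← hs, State.output]
  omega

/-! ### Programs that sample texts token by token -/

section Programs

variable {T : Type u} {ι : Type v}

@[simp] theorem length_ofTokens (x : List T) : (ofTokens x).length = x.length := by
  simp [ofTokens]

@[simp] theorem tokens_ofTokens (x : List T) : tokens (ofTokens x) = x := by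
  induction x with
  | nil => rfl
  | cons a x ih => simpa [tokens, ofTokens] using ih

/-- The token at the head of a string, with default `done`. -/
def headToken (done : T) (l : List (Sym T)) : T :=
  match l.head? with
  | some (Sum.inr t) => t
  | _ => done

theorem headToken_ofTokens (done : T) (x : List T) :
    headToken done (ofTokens x) = x.head?.getD done := by
  cases x <;> rfl

/-- The next token after the text `x`, extracted from the answer of an oracle. -/
def answerToken (done : T) (echo : Bool) (x : List T) (ans : List (Sym T)) : T :=
  headToken done (if echo then ans.drop x.length else ans)

/-- Push the head token of `src`, if it is in the list, to `dst`; otherwise push `done`. -/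
def pushTokenAux [DecidableEq T] (ι : Type v) (done : T) (src dst : ℕ) :
    List T → Prog (Sym T) ι
  | [] => .push dst (Sum.inr done)
  | t :: l => .ite src (fun o => decide (o = some (Sum.inr t))) (.push dst (Sum.inr t))
      (pushTokenAux ι done src dst l)

/-- Push the head token of `src` to `dst`. -/
def pushToken [Fintype T] [DecidableEq T] (ι : Type v) (done : T) (src dst : ℕ) :
    Prog (Sym T) ι :=
  pushTokenAux ι done src dst (Finset.univ : Finset T).toList

variable {O : Oracles (Sym T) ι}

theorem Triple.pushTokenAux [DecidableEq T] (done : T) (src dst : ℕ) (l : List T) :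
    ∀ s : State (Sym T), (∀ t, (s.regs src).head? = some (Sum.inr t) → t ∈ l) →
    Triple O (pushTokenAux ι done src dst l) (l.length + 1) s (PMF.pure ()) fun _ s' =>
      s'.regs = Function.update s.regs dst
        (Sum.inr (headToken done (s.regs src)) :: s.regs dst) ∧ s'.queries = s.queries := by
  induction l with
  | nil =>
    intro s hs
    refine (Triple.push _ _).mono (by simp) ?_
    rintro _ s' rfl
    have : headToken done (s.regs src) = done := by
      unfold headToken
      split
      · rename_i t ht
        exact absurd (hs t ht) (by simp)
      · rfl
    rw [this]
    exact ⟨rfl, rfl⟩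
  | cons t l ih =>
    intro s hs
    refine (Triple.ite (B := l.length + 1) ?_ ?_).le (by simp; omega)
    · intro ht
      rw [decide_eq_true_eq] at ht
      refine (Triple.push _ _).mono (by simp) ?_
      rintro _ s' rfl
      have : headToken done (s.regs src) = t := by simp [headToken, ht]
      rw [this]
      exact ⟨rfl, rfl⟩
    · intro ht
      rw [decide_eq_false_iff_not] at ht
      exact ih (s.tick 1) fun t' ht' => by
        rcases List.mem_cons.1 (hs t' ht') with rfl | h
        · exact absurd ht' ht
        · exact h

variable [Fintype T] [DecidableEq T]

theorem Triple.pushToken (done : T) (src dst : ℕ) (s : State (Sym T)) :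
    Triple O (pushToken ι done src dst) (Fintype.card T + 1) s (PMF.pure ()) fun _ s' =>
      s'.regs = Function.update s.regs dst
        (Sum.inr (headToken done (s.regs src)) :: s.regs dst) ∧ s'.queries = s.queries :=
  (Triple.pushTokenAux done src dst _ s fun t _ => by simp).le (by simp)

/-- Move the tokens in `src` to `dst`, reversing their order. -/
def moveTokens (ι : Type v) (done : T) (src dst : ℕ) : Prog (Sym T) ι :=
  .while src Option.isSome (.seq (pushToken ι done src dst) (.pop src))

theorem Triple.moveTokens (done : T) {src dst : ℕ} (hne : src ≠ dst) {s : State (Sym T)}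
    {x : List T} (hx : s.regs src = ofTokens x) {m : ℕ} (hm : x.length ≤ m) :
    Triple O (moveTokens ι done src dst) (m * (Fintype.card T + 3) + 1) s (PMF.pure ())
      fun _ s' => s'.regs src = [] ∧ s'.regs dst = ofTokens x.reverse ++ s.regs dst ∧
        (∀ r, r ≠ src → r ≠ dst → s'.regs r = s.regs r) ∧ s'.queries = s.queries := by
  have := Triple.while_det (O := O) (r := src) (test := Option.isSome)
    (p := .seq (Watermark.pushToken ι done src dst) (.pop src)) (B := Fintype.card T + 2)
    (R := fun s' => s'.regs src = [] ∧ s'.regs dst = ofTokens x.reverse ++ s.regs dst ∧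
        (∀ r, r ≠ src → r ≠ dst → s'.regs r = s.regs r) ∧ s'.queries = s.queries)
    (Inv := fun k s' => (∃ y : List T, y.length = k ∧ s'.regs src = ofTokens y ∧
      ofTokens y.reverse ++ s'.regs dst = ofTokens x.reverse ++ s.regs dst) ∧
      (∀ r, r ≠ src → r ≠ dst → s'.regs r = s.regs r) ∧ s'.queries = s.queries)
    ?_ ?_ ?_ x.length s ⟨⟨x, rfl, hx, rfl⟩, fun _ _ _ => rfl, rfl⟩
  · refine this.le ?_
    gcongr
  · rintro k s' ⟨⟨y, rfl, hy, -⟩, -⟩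
    cases y <;> simp [hy, ofTokens]
  · rintro k s' ⟨⟨y, hk, hy, hd⟩, hf, hq⟩
    refine Triple.seq_det (B₁ := Fintype.card T + 1) (B₂ := 1)
      (Triple.pushToken done src dst _) ?_
    rintro s₁ ⟨h1, h2⟩
    refine (Triple.pop _).post ?_
    rintro _ s₂ rfl
    cases y with
    | nil => simp at hk
    | cons t y =>
      refine ⟨⟨y, by simpa using hk, ?_, ?_⟩, ?_, ?_⟩
      · simp [h1, hne, hy, ofTokens]
      · rw [← hd]
        simp [h1, Function.update_apply, hne.symm, hy, ofTokens, headToken]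
      · intro r h3 h4
        simp [h1, Function.update_apply, h3, h4, hf]
      · simp [h2, hq]
  · rintro s' ⟨⟨y, hk, hy, hd⟩, hf, hq⟩
    rw [List.length_eq_zero_iff] at hk
    subst hk
    exact ⟨hy, by simpa [ofTokens] using hd, hf, hq⟩

omit [Fintype T] [DecidableEq T] in
/-- Drop as many symbols from register `6` as there are in register `5`. -/
theorem Triple.dropLoop {s : State (Sym T)} {m : ℕ} (hm : (s.regs 5).length ≤ m) :
    Triple O (.while 5 Option.isSome (.seq (.pop 5) (.pop 6))) (m * 3 + 1) s (PMF.pure ())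
      fun _ s' => s'.regs 5 = [] ∧ s'.regs 6 = (s.regs 6).drop (s.regs 5).length ∧
        (∀ r, r ≠ 5 → r ≠ 6 → s'.regs r = s.regs r) ∧ s'.queries = s.queries := by
  have := Triple.while_det (O := O) (r := 5) (test := Option.isSome)
    (p := .seq (.pop 5) (.pop 6)) (B := 2)
    (R := fun s' => s'.regs 5 = [] ∧ s'.regs 6 = (s.regs 6).drop (s.regs 5).length ∧
        (∀ r, r ≠ 5 → r ≠ 6 → s'.regs r = s.regs r) ∧ s'.queries = s.queries)
    (Inv := fun k s' => (s'.regs 5).length = k ∧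
      (s'.regs 6).drop k = (s.regs 6).drop (s.regs 5).length ∧
        (∀ r, r ≠ 5 → r ≠ 6 → s'.regs r = s.regs r) ∧ s'.queries = s.queries)
    ?_ ?_ ?_ _ s ⟨rfl, rfl, fun _ _ _ => rfl, rfl⟩
  · exact this.le (by gcongr)
  · rintro k s' ⟨rfl, -⟩
    cases s'.regs 5 <;> simp
  · rintro k s' ⟨h1, h2, h3, h4⟩
    refine Triple.seq_det (B₁ := 1) (B₂ := 1) (Triple.pop _) ?_
    rintro s₁ rfl
    refine (Triple.pop _).post ?_
    rintro _ s₂ rfl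
    refine ⟨by simp [h1], ?_, ?_, by simp [h4]⟩
    · simp [h2]
    · intro r h5 h6
      simp [h5, h6, h3]
  · rintro s' ⟨h1, h2, h3, h4⟩
    exact ⟨List.length_eq_zero_iff.1 h1, by simpa using h2, h3, h4⟩

/-- Clear the registers `10, …, 9 + j`, provided that register `7` is empty. -/
def clearRegs (T : Type u) (ι : Type v) : ℕ → Prog (Sym T) ι
  | 0 => .skip
  | j + 1 => .seq (clearRegs T ι j) (.copy 7 (10 + j))

omit [Fintype T] [DecidableEq T] in
theorem Triple.clearRegs {s : State (Sym T)} (h7 : s.regs 7 = []) (j : ℕ) :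
    Triple O (clearRegs T ι j) (j + 1) s (PMF.pure ()) fun _ s' =>
      (∀ r, s'.regs r = if 10 ≤ r ∧ r < 10 + j then [] else s.regs r) ∧
        s'.queries = s.queries := by
  induction j with
  | zero =>
    refine Triple.skip.mono le_rfl ?_
    rintro _ s' rfl
    refine ⟨fun r => ?_, rfl⟩
    rw [if_neg (by omega)]
    rfl
  | succ j ih =>
    refine Triple.seq_det (B₁ := j + 1) (B₂ := 1) ih ?_
    rintro s₁ ⟨h1, h2⟩
    have h3 : s₁.regs 7 = [] := by rw [h1, if_neg (by omega), h7]
    refine (Triple.copy _ _ (by simp [h3])).post ?_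
    rintro _ s₂ rfl
    refine ⟨fun r => ?_, by simp [h2]⟩
    simp only [State.regs_tick, State.regs_set, h3, h1]
    split_ifs <;> first | rfl | omega

/-! ### Sampling the next token -/

section Sample

variable (done : T) (echo : Bool) (f : Prompt T → List T → Prompt T)
  (F : PolyTimeProg (Sym T) Empty)

/-- Register `1` holds the prompt `q`, register `3` holds the reverse of the text `x`, register `7`
is empty, and so are all registers outside the work space of the subroutine `F`. -/
structure Holds (q : Prompt T) (x : List T) (s : State (Sym T)) : Prop where
  prompt : s.regs 1 = q
  text : s.regs 3 = ofTokens x.reverse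
  empty : s.regs 7 = []
  high : ∀ r, 10 + max 2 F.prog.width ≤ r → s.regs r = []

/-- Write the text whose reverse is in register `3` to register `5`. -/
def restoreText (ι : Type v) : Prog (Sym T) ι :=
  .seq (.copy 7 5) (.seq (.copy 3 4) (moveTokens ι done 4 5))

/-- Query the oracle `o` at `f q x`, extract the next token and append it to `x`. -/
def sampleToken (o : ι) : Prog (Sym T) ι :=
  .seq (restoreText done ι) (.seq (clearRegs T ι (max 2 F.prog.width)) (.seq (.copy 1 10)
    (.seq (.copy 5 11) (.seq (F.prog.lift ι 10) (.seq (.query o [10] 6)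
    (.seq (if echo then .while 5 Option.isSome (.seq (.pop 5) (.pop 6)) else .skip)
      (pushToken ι done 6 3)))))))

/-- A bound of the running time of `restoreText`. -/
def restoreTime (T : Type u) [Fintype T] (m : ℕ) : ℕ := 2 + m + (m * (Fintype.card T + 3) + 1)

/-- A bound of the running time of `sampleToken`. -/
def sampleTime (m : ℕ) : ℕ :=
  restoreTime T m + ((max 2 F.prog.width + 1) + ((1 + m) + ((1 + m) +
    ((F.time.eval m + 1) + ((1 + (F.time.eval m + m)) + ((m * 3 + 1) + (Fintype.card T + 1)))))))

omit [DecidableEq T] in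
theorem polyBounded_restoreTime : PolyBounded (restoreTime T) :=
  ((PolyBounded.const 2).add PolyBounded.id).add
    ((PolyBounded.id.mul (PolyBounded.const _)).add (PolyBounded.const 1))

omit [DecidableEq T] in
theorem polyBounded_sampleTime : PolyBounded (sampleTime F) := by
  have hc := fun c => PolyBounded.const c
  have hi := PolyBounded.id
  have hF := PolyBounded.eval F.time
  exact polyBounded_restoreTime.add ((hc _).add (((hc 1).add hi).add (((hc 1).add hi).add
    ((hF.add (hc 1)).add (((hc 1).add (hF.add hi)).add
    (((hi.mul (hc 3)).add (hc 1)).add (hc _)))))))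

variable {done F} {q : Prompt T} {x : List T} {s : State (Sym T)} {m : ℕ}

theorem Triple.restoreText (hs : Holds F q x s) (hm : x.length ≤ m) :
    Triple O (restoreText done ι) (restoreTime T m) s (PMF.pure ()) fun _ s' =>
      Holds F q x s' ∧ s'.regs 5 = ofTokens x ∧
      (∀ r, r ≠ 4 → r ≠ 5 → s'.regs r = s.regs r) ∧ s'.queries = s.queries := by
  refine Triple.le (B₁ := 1 + ((1 + m) + (m * (Fintype.card T + 3) + 1))) ?_
    (by simp [restoreTime]; omega)
  refine Triple.seq_det (Triple.copy _ _ (by simp [hs.empty])) ?_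
  rintro s₁ rfl
  refine Triple.seq_det (Triple.copy _ _ (by simp [hs.text, hm])) ?_
  rintro s₂ rfl
  refine (Triple.moveTokens done (by decide) (x := x.reverse) (by simp [hs.text])
    (by simpa using hm)).post ?_
  rintro _ s₃ ⟨h1, h2, h3, h4⟩
  have h5 : ∀ r, r ≠ 4 → r ≠ 5 → s₃.regs r = s.regs r := by
    intro r h5 h6
    rw [h3 r h5 h6]
    simp [h5, h6]
  refine ⟨⟨?_, ?_, ?_, ?_⟩, ?_, h5, ?_⟩
  · rw [h5 1 (by decide) (by decide), hs.prompt]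
  · rw [h5 3 (by decide) (by decide), hs.text]
  · rw [h5 7 (by decide) (by decide), hs.empty]
  · intro r hr
    rw [h5 r (by omega) (by omega), hs.high r hr]
  · simp [h2, hs.empty]
  · simp [h4]

variable {f}

/-- The text is stored in reverse, so appending a token is a push. The work space of `F` is cleared
first, since `F` is only specified on empty registers. All randomness comes from the single query,
whatever the oracle answers. -/
theorem Triple.sampleToken
    (hF : ∀ q x, ∀ s ∈ (F.run Empty.elim q (ofTokens x)).support, s.output = f q x) (o : ι)
    (hs : Holds F q x s) (hm : q.length + x.length ≤ m) :
    Triple O (sampleToken done echo F o) (sampleTime F m) s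
      ((O o [f q x]).map fun ans => x ++ [answerToken done echo x ans]) fun x' s' =>
      Holds F q x' s' ∧ (∀ r ∈ [0, 2, 8, 9], s'.regs r = s.regs r) ∧
      s'.queries = s.queries + 1 ∧ ∃ t, x' = x ++ [t] := by
  have hFm := F.time.eval_le_eval_of_le hm
  refine Triple.seq_det (Triple.restoreText hs (by omega)) ?_
  rintro s₁ ⟨h1, h15, h1f, h1q⟩
  refine Triple.seq_det (Triple.clearRegs h1.empty _) ?_
  rintro s₂ ⟨h2, h2q⟩
  refine Triple.seq_det (Triple.copy _ _ (by simp [h2, h1.prompt]; omega)) ?_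
  rintro s₃ rfl
  refine Triple.seq_det (Triple.copy _ _ (by simp [h2, h15]; omega)) ?_
  rintro s₄ rfl
  refine Triple.seq_det ((Triple.lift (hF q x) (by simp [h2, h1.prompt]) (by simp [h2, h15])
    ?_).le (by simpa using hFm)) ?_
  · intro r hr
    simp only [State.regs_tick, State.regs_set, h2]
    rw [if_neg (by omega), if_neg (by omega)]
    split
    · rfl
    · exact h1.high r (by omega)
  rintro s₅ ⟨h5, h5f, h5h, h5q⟩
  have hlen := PolyTimeProg.length_output_le (hF q x)
  rw [length_ofTokens] at hlen
  have h5f' : ∀ r, r < 10 → s₅.regs r = s₁.regs r := by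
    intro r hr
    rw [h5f r hr]
    simp only [State.regs_tick, State.regs_set, h2]
    rw [if_neg (by omega), if_neg (by omega), if_neg (by omega)]
  have h10 : [10].map s₅.regs = [f q x] := by simp [h5]
  rw [← h10]
  refine Triple.seq_map (Triple.query o [10] 6 ?_) ?_
  · simp [h5]
    omega
  · rintro ans s₆ ⟨h6, h6q⟩
    have h65 : s₆.regs 5 = ofTokens x := by
      simp [h6, h5f', h15]
    refine Triple.seq_det (R := fun _ s' =>
      s'.regs 6 = (if echo then ans.drop x.length else ans) ∧
      (∀ r, r ≠ 5 → r ≠ 6 → s'.regs r = s₆.regs r) ∧ s'.queries = s₆.queries) ?_ ?_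
    · cases echo
      · refine Triple.skip.mono (by omega) ?_
        rintro _ s' rfl
        exact ⟨by simp [h6], fun _ _ _ => rfl, rfl⟩
      · refine (Triple.dropLoop (by simp [h65]; omega)).mono le_rfl ?_
        rintro _ s' ⟨-, h2, h3, h4⟩
        exact ⟨by simp [h2, h65, h6], h3, h4⟩
    rintro s₇ ⟨h7, h7f, h7q⟩
    refine (Triple.pushToken done 6 3 s₇).post ?_
    rintro _ s₈ ⟨h8, h8q⟩
    have h8' : ∀ r, r ≠ 3 → r ≠ 5 → r ≠ 6 → s₈.regs r = s₅.regs r := by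
      intro r h3 h5 h6'
      rw [h8, Function.update_of_ne h3, h7f r h5 h6', h6, Function.update_of_ne h6']
    refine ⟨⟨?_, ?_, ?_, ?_⟩, ?_, ?_, _, rfl⟩
    · rw [h8' 1 (by decide) (by decide) (by decide), h5f' 1 (by decide), h1.prompt]
    · rw [h8, Function.update_self, h7, h7f 3 (by decide) (by decide), h6,
        Function.update_of_ne (by decide), h5f' 3 (by decide), h1.text]
      simp [ofTokens, answerToken]
    · rw [h8' 7 (by decide) (by decide) (by decide), h5f' 7 (by decide), h1.empty]
    · intro r hr
      rw [h8' r (by omega) (by omega) (by omega), h5h r hr]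
    · intro r hr
      have : r ≠ 3 ∧ r ≠ 4 ∧ r ≠ 5 ∧ r ≠ 6 ∧ r < 10 := by
        simp only [List.mem_cons, List.not_mem_nil, or_false] at hr
        omega
      rw [h8' r this.1 this.2.2.1 this.2.2.2.1, h5f' r this.2.2.2.2,
        h1f r this.2.1 this.2.2.1]
    · simp [h8q, h7q, h6q, h5q, h2q, h1q]

/-! ### Generating a text -/

omit [Fintype T] in
theorem generate_eq_iterUntil (next : List T → PMF T) (k : ℕ) (x : List T) :
    generate done next k x = iterUntil (fun x => (next x).map fun t => x ++ [t])
      (fun x => decide (x.getLast? = some done)) k x := by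
  induction k generalizing x with
  | zero => rfl
  | succ k ih =>
    simp only [generate, iterUntil, decide_eq_true_eq, PMF.bind_map]
    split
    · rfl
    · congr 1
      funext t
      exact ih _

variable (done F) in
/-- Sample tokens until `done` is sampled, but at most as many as there are symbols in
register `2`. -/
def sampleText (o : ι) : Prog (Sym T) ι :=
  .while 2 Option.isSome (.seq (sampleToken done echo F o)
    (.ite 3 (fun a => decide (a = some (Sum.inr done))) (.copy 7 2) (.pop 2)))

/-- Register `2` is both the remaining budget and the stop flag: it is emptied as soon as `done` is
sampled. -/
theorem Triple.sampleText
    (hF : ∀ q x, ∀ s ∈ (F.run Empty.elim q (ofTokens x)).support, s.output = f q x) (o : ι)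
    (hs : Holds F q [] s) {k : ℕ} (hk : (s.regs 2).length = k) (hm : q.length + k ≤ m) :
    Triple O (sampleText done echo F o) (m * (sampleTime F m + 3) + 1) s
      (generate done (fun x => (O o [f q x]).map (answerToken done echo x)) k []) fun x s' =>
      Holds F q x s' ∧ x.length ≤ k ∧ (∀ r ∈ [0, 8, 9], s'.regs r = s.regs r) ∧
      s'.queries = s.queries + x.length := by
  have := Triple.while_loop (O := O) (r := 2) (test := Option.isSome)
    (p := .seq (Watermark.sampleToken done echo F o)
      (.ite 3 (fun a => decide (a = some (Sum.inr done))) (.copy 7 2) (.pop 2)))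
    (B := sampleTime F m + 2)
    (f := fun x => ((O o [f q x]).map (answerToken done echo x)).map fun t => x ++ [t])
    (halted := fun x => decide (x.getLast? = some done))
    (R := fun x s' => Holds F q x s' ∧ x.length ≤ k ∧ (∀ r ∈ [0, 8, 9], s'.regs r = s.regs r) ∧
      s'.queries = s.queries + x.length)
    (Inv := fun j x s' => Holds F q x s' ∧
      (s'.regs 2).length = (if x.getLast? = some done then 0 else j) ∧ x.length + j ≤ k ∧
      (∀ r ∈ [0, 8, 9], s'.regs r = s.regs r) ∧ s'.queries = s.queries + x.length)
    ?_ ?_ ?_ k [] s ⟨hs, by simpa using hk, by simp, fun _ _ => rfl, by simp⟩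
  · rw [generate_eq_iterUntil]
    refine this.le ?_
    gcongr
    · omega
  · rintro j x s' ⟨-, h2, -⟩
    have : (s'.regs 2).head?.isSome = true ↔ (s'.regs 2).length ≠ 0 := by
      cases s'.regs 2 <;> simp
    rw [this, h2]
    split_ifs with h <;> simp [h]
  · rintro j x s' ⟨h1, h2, h3, h4, h5⟩ hhalted
    rw [decide_eq_false_iff_not] at hhalted
    rw [if_neg hhalted] at h2
    rw [PMF.map_comp]
    have h1' : Holds F q x (s'.tick 1) := ⟨h1.prompt, h1.text, h1.empty, h1.high⟩
    -- Updating the counter is deterministic, so it contributes `PMF.pure` to the law of the loop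
    -- body.
    have := Triple.seq (f := PMF.pure) (q := .ite 3 (fun a => decide (a = some (Sum.inr done)))
      (.copy 7 2) (.pop 2)) (B₂ := 2)
      (S := fun x s' => Holds F q x s' ∧
        (s'.regs 2).length = (if x.getLast? = some done then 0 else j) ∧ x.length + j ≤ k ∧
        (∀ r ∈ [0, 8, 9], s'.regs r = s.regs r) ∧ s'.queries = s.queries + x.length)
      (Triple.sampleToken (O := O) (done := done) echo hF o h1' (m := m) (by omega)) ?_
    · rwa [PMF.bind_pure] at this
    · rintro x' s₁ ⟨g1, g2, g3, t, ht⟩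
      have g4 : x'.length = x.length + 1 := by simp [ht]
      have hhead : (s₁.regs 3).head? = x'.getLast?.map Sum.inr := by
        rw [g1.text, ofTokens, List.head?_map, List.head?_reverse]
      have hr : ∀ r ∈ [0, 8, 9], s₁.regs r = s.regs r := by
        intro r hr
        rw [g2 r (by simp at hr ⊢; tauto), State.regs_tick, h4 r hr]
      have hq : s₁.queries = s.queries + x'.length := by
        rw [g3, State.queries_tick, h5, g4]; omega
      refine Triple.ite (B := 1) ?_ ?_
      · intro ht
        rw [decide_eq_true_eq, hhead] at ht
        have hl : x'.getLast? = some done := by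
          cases h : x'.getLast? with
          | none => simp [h] at ht
          | some t => simpa [h] using ht
        refine (Triple.copy (s := s₁.tick 1) 7 2 (B := 1) (by simp [g1.empty])).of_unit _ ?_
        rintro s₂ rfl
        refine ⟨⟨by simp [g1.prompt], by simp [g1.text], by simp [g1.empty], ?_⟩, ?_, by omega,
          ?_, by simpa using hq⟩
        · intro r hr
          simp [show r ≠ 2 by omega, g1.high r hr]
        · simp [hl, g1.empty]
        · intro r hr'
          have : r ≠ 2 := by rintro rfl; simp at hr'
          simp [this, hr r hr']
      · intro ht
        rw [decide_eq_false_iff_not, hhead] at ht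
        have hl : x'.getLast? ≠ some done := by
          intro h
          simp [h] at ht
        refine (Triple.pop (s := s₁.tick 1) 2).of_unit _ ?_
        rintro s₂ rfl
        refine ⟨⟨by simp [g1.prompt], by simp [g1.text], by simp [g1.empty], ?_⟩, ?_, by omega,
          ?_, by simpa using hq⟩
        · intro r hr
          simp [show r ≠ 2 by omega, g1.high r hr]
        · have := g2 2 (by simp)
          simp [hl, this, h2]
        · intro r hr'
          have : r ≠ 2 := by rintro rfl; simp at hr'
          simp [this, hr r hr']
  · rintro j x s' ⟨h1, h2, h3, h4, h5⟩ -
    exact ⟨⟨h1.prompt, h1.text, h1.empty, h1.high⟩, by omega, h4, h5⟩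

end Sample

end Programs

/-! ### The attacker and its budget of tokens -/

section Attack

variable {T : Type u} {ι : Type v} [Fintype T] [DecidableEq T] {O : Oracles (Sym T) ι}
  {done : T} (echo : Bool) {f : Prompt T → List T → Prompt T}
  {F : PolyTimeProg (Sym T) Empty} {q : Prompt T} {x : List T} {s : State (Sym T)} {m : ℕ}

/-! ### A counter of polynomial length -/

/-- Multiply the length of register `2` by the successor of the length of register `1`. -/
def mulCounter (T : Type u) (ι : Type v) : Prog (Sym T) ι :=
  .seq (.copy 7 4) (.seq
    (.while 2 Option.isSome (.seq (.pop 2) (.seq (.push 4 (Sum.inl true)) (.seq (.copy 1 5)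
      (.while 5 Option.isSome (.seq (.pop 5) (.push 4 (Sum.inl true))))))))
    (.copy 4 2))

/-- Registers `1`, `7` and those that are not listed are unchanged. -/
def CounterFrame (s s' : State (Sym T)) : Prop :=
  (∀ r, r ≠ 2 → r ≠ 4 → r ≠ 5 → s'.regs r = s.regs r) ∧ s'.queries = s.queries

omit [Fintype T] [DecidableEq T] in
theorem CounterFrame.trans {s₁ s₂ s₃ : State (Sym T)} (h : CounterFrame s₁ s₂)
    (h' : CounterFrame s₂ s₃) : CounterFrame s₁ s₃ :=
  ⟨fun r h2 h4 h5 => (h'.1 r h2 h4 h5).trans (h.1 r h2 h4 h5), h'.2.trans h.2⟩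

omit [Fintype T] [DecidableEq T] in
-- For each symbol of register `2`, one symbol plus a copy of register `1` is added to register `4`,
-- which gives the factor `l + 1`.
theorem Triple.mulCounter (h7 : s.regs 7 = []) {k : ℕ} (hk : (s.regs 2).length = k) {l : ℕ}
    (hl : (s.regs 1).length = l) :
    Triple O (mulCounter T ι) (3 + k * (5 * l + 6)) s (PMF.pure ()) fun _ s' =>
      (s'.regs 2).length = k * (l + 1) ∧ CounterFrame s s' := by
  refine Triple.le (B₁ := 1 + ((k * ((1 + (1 + ((1 + l) + (l * 3 + 1)))) + 1) + 1) +
    (1 + k * (l + 1)))) ?_ (by ring_nf; omega)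
  refine Triple.seq_det (Triple.copy _ _ (by simp [h7])) ?_
  rintro s₀ rfl
  refine Triple.seq_det (R := fun _ s' => (s'.regs 4).length = k * (l + 1) ∧
    CounterFrame s s') ?_ ?_
  · refine Triple.while_det (Inv := fun j s' => (s'.regs 2).length = j ∧
      (s'.regs 4).length + j * (l + 1) = k * (l + 1) ∧ CounterFrame s s') ?_ ?_ ?_ k _ ?_
    · rintro j s' ⟨rfl, -⟩
      cases s'.regs 2 <;> simp
    · rintro j s' ⟨h1, h2, h3, h4⟩
      refine Triple.seq_det (Triple.pop _) ?_
      rintro s₁ rfl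
      refine Triple.seq_det (Triple.push _ _) ?_
      rintro s₂ rfl
      refine Triple.seq_det (Triple.copy _ _ (by simp [h3, hl])) ?_
      rintro s₃ rfl
      refine Triple.while_det (B := 2)
        (Inv := fun i s' => (s'.regs 2).length = j ∧ (s'.regs 5).length = i ∧
          (s'.regs 4).length + i + j * (l + 1) = k * (l + 1) ∧ CounterFrame s s')
        ?_ ?_ ?_ l _ ?_
      · rintro i s' ⟨-, rfl, -⟩
        cases s'.regs 5 <;> simp
      · rintro i s' ⟨h1, h2, h3, h4, h5⟩
        refine Triple.seq_det (B₁ := 1) (B₂ := 1) (Triple.pop _) ?_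
        rintro s₁ rfl
        refine (Triple.push _ _).post ?_
        rintro _ s₂ rfl
        refine ⟨by simp [h1], by simp [h2], ?_, ?_, by simp [h5]⟩
        · simp
          omega
        · intro r g1 g2 g3
          simp [g2, g3, h4 r g1 g2 g3]
      · rintro s' ⟨h1, h2, h3, h4⟩
        exact ⟨h1, by simpa using h3, h4⟩
      · refine ⟨by simp [h1], by simp [h3, hl], ?_, ?_, by simpa using h4⟩
        · simp
          rw [add_mul] at h2
          omega
        · intro r g1 g2 g3
          simp [g1, g2, g3, h3 r g1 g2 g3]
    · rintro s' ⟨h1, h2, h3⟩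
      exact ⟨by simpa using h2, h3⟩
    · refine ⟨by simp [hk], by simp [h7], ?_, by simp⟩
      intro r g1 g2 g3
      simp [g2]
  · rintro s₁ ⟨h1, h2, h3⟩
    refine (Triple.copy _ _ (by simp [h1])).post ?_
    rintro _ s₂ rfl
    refine ⟨by simp [h1], ?_, by simpa using h3⟩
    intro r g1 g2 g3
    simp [g1, h2 r g1 g2 g3]

/-- Give register `2`, if it is empty, the length `c * (l + 1) ^ d`, where `l` is the length of
register `1`. -/
def polyCounter (T : Type u) (ι : Type v) (c : ℕ) : ℕ → Prog (Sym T) ι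
  | 0 => c.rec .skip fun _ p => .seq p (.push 2 (Sum.inl true))
  | d + 1 => .seq (polyCounter T ι c d) (mulCounter T ι)

/-- A bound of the running time of `polyCounter`. -/
def polyCounterTime (c : ℕ) : ℕ → ℕ → ℕ
  | 0, _ => c + 1
  | d + 1, l => polyCounterTime c d l + (3 + c * (l + 1) ^ d * (5 * l + 6))

theorem polyBounded_polyCounterTime (c d : ℕ) : PolyBounded (polyCounterTime c d) := by
  have hc := fun c => PolyBounded.const c
  have hi := PolyBounded.id
  induction d with
  | zero => exact hc _
  | succ d ih =>
    exact ih.add ((hc 3).add (((hc c).mul ((hi.add (hc 1)).pow d)).mul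
      (((hc 5).mul hi).add (hc 6))))

omit [Fintype T] [DecidableEq T] in
theorem Triple.polyCounter (c d : ℕ) (h7 : s.regs 7 = []) (h2 : s.regs 2 = []) {l : ℕ}
    (hl : (s.regs 1).length = l) :
    Triple O (polyCounter T ι c d) (polyCounterTime c d l) s (PMF.pure ()) fun _ s' =>
      (s'.regs 2).length = c * (l + 1) ^ d ∧ CounterFrame s s' := by
  induction d with
  | zero =>
    simp only [Watermark.polyCounter, polyCounterTime, pow_zero, mul_one]
    induction c with
    | zero =>
      refine Triple.skip.post ?_
      rintro _ s' rfl
      exact ⟨by simp [h2], fun _ _ _ _ => rfl, rfl⟩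
    | succ c ih =>
      refine Triple.seq_det ih ?_
      rintro s₁ ⟨g1, g2, g3⟩
      refine (Triple.push _ _).post ?_
      rintro _ s₂ rfl
      refine ⟨by simp [g1], ?_, by simpa using g3⟩
      intro r k1 k2 k3
      simp [k1, g2 r k1 k2 k3]
  | succ d ih =>
    refine Triple.seq_det ih ?_
    rintro s₁ ⟨g1, g2⟩
    refine (Triple.mulCounter (by rw [g2.1 7 (by decide) (by decide) (by decide), h7]) g1
      (by rw [g2.1 1 (by decide) (by decide) (by decide), hl])).post ?_
    rintro _ s₂ ⟨k1, k2⟩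
    exact ⟨by rw [k1, pow_succ, mul_assoc], g2.trans k2⟩

/-! ### The attacker -/

variable (done F) in
/-- The program of the attacker. -/
def attackProg (c d : ℕ) : Prog (Sym T) Unit :=
  .seq (polyCounter T Unit c d) (.seq (sampleText done echo F ())
    (.seq (.copy 7 0) (moveTokens Unit done 3 0)))

/-- A bound of the running time of the attacker. -/
def attackTime (F : PolyTimeProg (Sym T) Empty) (c d : ℕ) (l : ℕ) : ℕ :=
  polyCounterTime c d l + (((l + c * (l + 1) ^ d) * (sampleTime F (l + c * (l + 1) ^ d) + 3) + 1) +
    (1 + (c * (l + 1) ^ d * (Fintype.card T + 3) + 1)))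

omit [DecidableEq T] in
theorem polyBounded_attackTime (c d : ℕ) : PolyBounded (attackTime F c d) := by
  have hc := fun c => PolyBounded.const c
  have hi := PolyBounded.id
  have hp := (hc c).mul ((hi.add (hc 1)).pow d)
  have hm := hi.add hp
  exact (polyBounded_polyCounterTime c d).add
    (((hm.mul (((polyBounded_sampleTime F).comp hm).add (hc 3))).add (hc 1)).add
    ((hc 1).add ((hp.mul (hc _)).add (hc 1))))

/-- The law of the next token obtained by asking `w` for a continuation of the text `x`. -/
def stepLaw (done : T) (echo : Bool) (f : Prompt T → List T → Prompt T)
    (w : Prompt T → PMF (List T)) (q : Prompt T) (x : List T) : PMF T :=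
  (w (f q x)).map fun r => (if echo then r.drop x.length else r).head?.getD done

omit [Fintype T] [DecidableEq T] in
-- Passage from the answers seen by a program to the laws of tokens used in the probabilistic part.
theorem map_textOracle (w : Prompt T → PMF (List T)) (x : List T) :
    (textOracle w [f q x]).map (answerToken done echo x) = stepLaw done echo f w q x := by
  rw [textOracle, PMF.map_comp, stepLaw]
  congr 1
  funext r
  simp only [Function.comp, answerToken, ← headToken_ofTokens]
  cases echo <;> simp [ofTokens]

omit [Fintype T] [DecidableEq T] in
theorem Holds.init (F : PolyTimeProg (Sym T) Empty) (x y : List (Sym T)) :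
    Holds F y [] (State.init x y) := by
  refine ⟨rfl, rfl, rfl, fun r hr => ?_⟩
  simp only [State.init]
  rw [if_neg (by omega), if_neg (by omega)]

omit [DecidableEq T] in
-- The attacker's work depends on the length of the prompt alone, whereas `PolyTimeProg` measures
-- time in the total input length.
theorem attackTime_mono (c d : ℕ) {l l' : ℕ} (h : l ≤ l') :
    attackTime F c d l ≤ attackTime F c d l' := by
  have h1 : ∀ d, polyCounterTime c d l ≤ polyCounterTime c d l' := by
    intro d
    induction d with
    | zero => exact le_rfl
    | succ d ih => simp only [polyCounterTime]; gcongr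
  have h2 : ∀ {a b : ℕ}, a ≤ b → sampleTime F a ≤ sampleTime F b := by
    intro a b hab
    have := F.time.eval_le_eval_of_le hab
    simp only [sampleTime, restoreTime]
    gcongr
  simp only [attackTime]
  gcongr
  · exact h1 d
  · exact h2 (by gcongr)

/-- The budget `c * (q.length + 1) ^ d` will be chosen to dominate the model's bound, so that
cutting off at the budget never truncates a response of the model. The query count is exact for
every oracle, since an answer without a usable token still yields `done`. -/
theorem exists_attacker
    (hF : ∀ q x, ∀ s ∈ (F.run Empty.elim q (ofTokens x)).support, s.output = f q x) (c d : ℕ) :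
    ∃ A : Attacker T,
      (∀ (w : Prompt T → PMF (List T)) (n : ℕ) (q : Prompt T),
        ∀ s ∈ (A.run w n q).support, s.queries = (tokens s.output).length) ∧
      ∀ (w : Prompt T → PMF (List T)) (n : ℕ) (q : Prompt T),
        A.text w n q = generate done (stepLaw done echo f w q) (c * (q.length + 1) ^ d) [] := by
  have key : ∀ (O : Oracles (Sym T) Unit) (x q : List (Sym T)),
      Triple O (attackProg done echo F c d) (attackTime F c d (x.length + q.length))
        (State.init x q) (generate done (fun x => (O () [f q x]).map (answerToken done echo x))
          (c * (q.length + 1) ^ d) [])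
        fun x s => s.regs 0 = ofTokens x ∧ s.queries = x.length := by
    intro O x q
    refine Triple.le ?_ (attackTime_mono c d (Nat.le_add_left q.length x.length))
    have h0 := Holds.init F x q
    refine Triple.seq_det (Triple.polyCounter c d h0.empty rfl rfl) ?_
    rintro s₁ ⟨h1, h2, h2q⟩
    have h3 : Holds F q [] s₁ := by
      refine ⟨?_, ?_, ?_, fun r hr => ?_⟩
      · rw [h2 _ (by decide) (by decide) (by decide), h0.prompt]
      · rw [h2 _ (by decide) (by decide) (by decide), h0.text]
      · rw [h2 _ (by decide) (by decide) (by decide), h0.empty]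
      · rw [h2 _ (by omega) (by omega) (by omega), h0.high r hr]
    have key := Triple.seq_map (g := id) (q := .seq (.copy 7 0) (moveTokens Unit done 3 0))
      (B₂ := 1 + (c * (q.length + 1) ^ d * (Fintype.card T + 3) + 1))
      (S := fun x s => s.regs 0 = ofTokens x ∧ s.queries = x.length)
      (Triple.sampleText (O := O) (done := done) echo hF () h3 h1 le_rfl) ?_
    · rw [PMF.map_id] at key
      exact key
    · rintro y s₂ ⟨h4, h5, h6, h7⟩
      -- Register `0` still holds the input `1^n`; it is erased before the text is moved there, and
      -- the move undoes the reversal.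
      refine Triple.seq_det (Triple.copy _ _ (by simp [h4.empty])) ?_
      rintro s₃ rfl
      refine (Triple.moveTokens done (by decide) (x := y.reverse) (by simp [h4.text])
        (by simpa using h5)).post ?_
      rintro _ s₄ ⟨-, h8, -, h9⟩
      refine ⟨by simp [h8, h4.empty], ?_⟩
      rw [h9]
      simp [h7, h2q, State.init]
  obtain ⟨A, hA⟩ := exists_polyTimeProg _ (polyBounded_attackTime (F := F) c d) key
  refine ⟨A, ?_, ?_⟩
  · intro w n q s hs
    obtain ⟨ν, h1, -, h3⟩ := hA (fun _ => textOracle w) (unary T n) q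
    rw [Attacker.run, h1] at hs
    obtain ⟨z, hz, rfl⟩ := (PMF.mem_support_map_iff _ _ _).1 hs
    obtain ⟨h4, h5⟩ := h3 z hz
    rw [State.output, h4, h5, tokens_ofTokens]
  · intro w n q
    obtain ⟨ν, h1, h2, h3⟩ := hA (fun _ => textOracle w) (unary T n) q
    rw [Attacker.text, Attacker.run, h1, PMF.map_comp]
    simp only [map_textOracle] at h2
    rw [← h2]
    refine map_congr_support fun z hz => ?_
    simp [State.output, (h3 z hz).1]

end Attack

/-! ### The distinguishers: two independent draws of a token after the same text -/

section Distinguish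

variable {T : Type u} {ι : Type v} {O : Oracles (Sym T) ι}
  {done : T} {echo : Bool} {f : Prompt T → List T → Prompt T}
  {F : PolyTimeProg (Sym T) Empty} {q : Prompt T} {x : List T} {s : State (Sym T)} {m : ℕ}

/-! ### Bits -/

/-- The string begins with the bit `1`. -/
def headBit (l : List (Sym T)) : Bool :=
  match l.head? with
  | some (Sum.inl true) => true
  | _ => false

/-- The test whether the top symbol is the bit `1`. -/
def isOne (a : Option (Sym T)) : Bool :=
  match a with
  | some (Sum.inl true) => true
  | _ => false

theorem isOne_head? (l : List (Sym T)) : isOne l.head? = headBit l := rfl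

/-- Store a bit in register `8`. -/
def setBit (T : Type u) (ι : Type v) (b : Bool) : Prog (Sym T) ι :=
  .seq (.copy 7 8) (.push 8 (Sum.inl b))

theorem Triple.setBit (h7 : s.regs 7 = []) (b : Bool) :
    Triple O (setBit T ι b) 2 s (PMF.pure ()) fun _ s' =>
      s'.regs = Function.update s.regs 8 [Sum.inl b] := by
  refine Triple.seq_det (B₁ := 1) (B₂ := 1) (Triple.copy _ _ (by simp [h7])) ?_
  rintro s₁ rfl
  refine (Triple.push _ _).post ?_
  rintro _ s₂ rfl
  funext r
  simp only [State.regs_tick, State.regs_set, Function.update_apply, h7]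
  split_ifs <;> rfl

/-- A fair coin decides whether the bit `v` is replaced by the next bit of the string. -/
def coinStep (a : Bool × List (Sym T)) : PMF (Bool × List (Sym T)) :=
  (PMF.uniformOfFintype Bool).map fun c => (if c then headBit a.2 else a.1, a.2.tail)

/-- If the string is the binary representation of `a ≤ 2 ^ k`, beginning with the lowest bit,
then this is `true` with probability `a / 2 ^ k`. -/
def bitLaw (k : ℕ) (l : List (Sym T)) : PMF Bool :=
  (iterUntil coinStep (fun _ => false) k (false, l)).map fun a => headBit a.2 || a.1

/-- Draw a bit according to the binary number in register `6`, with as many binary digits as there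
are symbols in register `0`. -/
def drawBit (T : Type u) (ι : Type v) : Prog (Sym T) ι :=
  .seq (setBit T ι false) (.seq (.copy 0 4) (.seq
    (.while 4 Option.isSome (.seq (.pop 4) (.seq (.flip 9 (Sum.inl true) (Sum.inl false))
      (.seq (.ite 9 isOne (.ite 6 isOne (setBit T ι true) (setBit T ι false)) .skip) (.pop 6)))))
    (.ite 6 isOne (setBit T ι true) .skip)))

theorem Triple.drawBit (h7 : s.regs 7 = []) (hm : (s.regs 0).length ≤ m) :
    Triple O (drawBit T ι) (2 + ((1 + m) + ((m * 8 + 1) + 3))) s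
      (bitLaw (s.regs 0).length (s.regs 6)) fun b s' => s'.regs 8 = [Sum.inl b] ∧
        ∀ r, r ≠ 4 → r ≠ 6 → r ≠ 8 → r ≠ 9 → s'.regs r = s.regs r := by
  refine Triple.seq_det (Triple.setBit h7 _) ?_
  intro s₁ h1
  refine Triple.seq_det (Triple.copy _ _ (by simp [h1, hm])) ?_
  rintro s₂ rfl
  refine Triple.seq_map (R := fun a s' => (s'.regs 8 = [Sum.inl a.1] ∧ s'.regs 6 = a.2) ∧
    ∀ r, r ≠ 4 → r ≠ 6 → r ≠ 8 → r ≠ 9 → s'.regs r = s.regs r) ?_ ?_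
  · have := Triple.while_loop (O := O) (r := 4) (test := Option.isSome) (B := 7)
      (p := .seq (.pop 4) (.seq (.flip 9 (Sum.inl true) (Sum.inl false))
        (.seq (.ite 9 isOne (.ite 6 isOne (Watermark.setBit T ι true)
          (Watermark.setBit T ι false)) .skip) (.pop 6))))
      (f := coinStep) (halted := fun _ => false)
      (R := fun a s' => (s'.regs 8 = [Sum.inl a.1] ∧ s'.regs 6 = a.2) ∧
        ∀ r, r ≠ 4 → r ≠ 6 → r ≠ 8 → r ≠ 9 → s'.regs r = s.regs r)
      (Inv := fun k a s' => ((s'.regs 8 = [Sum.inl a.1] ∧ s'.regs 6 = a.2) ∧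
        ∀ r, r ≠ 4 → r ≠ 6 → r ≠ 8 → r ≠ 9 → s'.regs r = s.regs r) ∧ (s'.regs 4).length = k)
      ?_ ?_ ?_ (s.regs 0).length (false, s.regs 6)
      ((s₁.set 4 (s₁.regs 0)).tick (1 + (s₁.regs 0).length)) ?_
    · exact this.le (by gcongr)
    · rintro k a s' ⟨-, rfl⟩
      cases s'.regs 4 <;> simp
    · rintro k a s' ⟨⟨⟨h8, h6⟩, hf⟩, h4⟩ -
      refine Triple.seq_det (B₁ := 1) (B₂ := 6) (Triple.pop _) ?_
      rintro s₃ rfl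
      refine Triple.seq_map (B₁ := 1) (B₂ := 5) (Triple.flip _ _ _) ?_
      rintro c s₄ rfl
      refine Triple.seq_det (B₁ := 4) (B₂ := 1) (R := fun _ s' =>
        (s'.regs 8 = [Sum.inl (if c then headBit a.2 else a.1)] ∧ s'.regs 6 = a.2 ∧
        ∀ r, r ≠ 4 → r ≠ 6 → r ≠ 8 → r ≠ 9 → s'.regs r = s.regs r) ∧ (s'.regs 4).length = k) ?_ ?_
      · refine Triple.ite (B := 3) ?_ ?_
        · intro hc
          have hc' : c = true := by
            cases c
            · simp [isOne] at hc
            · rfl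
          subst hc'
          refine Triple.ite (B := 2) ?_ ?_
          · intro hb
            have hb' : headBit a.2 = true := by
              simpa [isOne_head?, h6] using hb
            refine (Triple.setBit (by simp [hf 7, h7]) _).post ?_
            intro _ s₅ h5
            refine ⟨⟨by simp [h5, hb'], by simp [h5, h6], ?_⟩, by simp [h5, h4]⟩
            intro r g1 g2 g3 g4
            simp [h5, g1, g3, g4, hf r g1 g2 g3 g4]
          · intro hb
            have hb' : headBit a.2 = false := by
              simpa [isOne_head?, h6] using hb
            refine (Triple.setBit (by simp [hf 7, h7]) _).post ?_
            intro _ s₅ h5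
            refine ⟨⟨by simp [h5, hb'], by simp [h5, h6], ?_⟩, by simp [h5, h4]⟩
            intro r g1 g2 g3 g4
            simp [h5, g1, g3, g4, hf r g1 g2 g3 g4]
        · intro hc
          have hc' : c = false := by
            cases c
            · rfl
            · simp [isOne] at hc
          subst hc'
          refine Triple.skip.mono (by decide) ?_
          rintro _ s₅ rfl
          refine ⟨⟨by simp [h8], by simp [h6], ?_⟩, by simp [h4]⟩
          intro r g1 g2 g3 g4
          simp [g1, g4, hf r g1 g2 g3 g4]
      · rintro s₅ ⟨⟨k8, k6, kf⟩, k4⟩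
        refine (Triple.pop _).post ?_
        rintro _ s₆ rfl
        refine ⟨⟨⟨by simp [k8], by simp [k6]⟩, ?_⟩, by simp [k4]⟩
        intro r g1 g2 g3 g4
        simp [g2, kf r g1 g2 g3 g4]
    · rintro k a s' ⟨h, -⟩ -
      exact h
    · refine ⟨⟨⟨by simp [h1], by simp [h1]⟩, ?_⟩, by simp [h1]⟩
      intro r g1 g2 g3 g4
      simp [g1, h1, g3]
  · rintro a s₃ ⟨⟨k8, k6⟩, kf⟩
    refine Triple.ite (B := 2) ?_ ?_
    · intro hb
      have hb' : headBit a.2 = true := by simpa [isOne_head?, k6] using hb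
      refine (Triple.setBit (by simp [kf 7, h7]) _).post ?_
      intro _ s₅ h5
      refine ⟨by simp [h5, hb'], ?_⟩
      intro r g1 g2 g3 g4
      simp [h5, g3, kf r g1 g2 g3 g4]
    · intro hb
      have hb' : headBit a.2 = false := by simpa [isOne_head?, k6] using hb
      refine Triple.skip.mono (by decide) ?_
      rintro _ s₅ rfl
      refine ⟨by simp [k8, hb'], ?_⟩
      intro r g1 g2 g3 g4
      simp [kf r g1 g2 g3 g4]

/-! ### The distinguisher -/

variable [Fintype T] [DecidableEq T] {z₀ y : List (Sym T)} {t : T}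
  {P : Oracles (Sym T) DistOracle}

variable (done echo F) in
/-- Unless the text ends in `done`, store in register `8` whether the next token is `t`, where
the next token is sampled with the text oracle if `c = true` and with the model oracle if
`c = false`. -/
def drawToken (t : T) (c : Bool) : Prog (Sym T) DistOracle :=
  .ite 3 (fun a => decide (a = some (Sum.inr done))) (setBit T _ false)
    (if c then
      .seq (sampleToken done echo F .text)
        (.seq (.ite 3 (fun a => decide (a = some (Sum.inr t))) (setBit T _ true) (setBit T _ false))
          (.pop 3))
    else
      .seq (restoreText done _) (.seq (.copy 7 9) (.seq (.push 9 (Sum.inr t))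
        (.seq (.query .model [1, 5, 9, 0] 6) (drawBit T _)))))

variable (done echo f) in
/-- The law of the bit that is computed by `drawToken`. -/
def drawLaw (P : Oracles (Sym T) DistOracle) (q : Prompt T) (a : List (Sym T)) (t : T) (c : Bool)
    (x : List T) : PMF Bool :=
  if x.getLast? = some done then PMF.pure false
  else if c then ((P .text [f q x]).map (answerToken done echo x)).map fun t' => decide (t' = t)
  else (P .model [q, ofTokens x, [Sum.inr t], a]).bind (bitLaw a.length)

/-- A bound of the running time of `drawToken`. -/
def drawTime (F : PolyTimeProg (Sym T) Empty) (m : ℕ) : ℕ :=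
  1 + ((sampleTime F m + 4) + (restoreTime T m + (1 + (1 + ((2 + 3 * m) +
    (2 + ((1 + m) + ((m * 8 + 1) + 3))))))))

omit [DecidableEq T] in
theorem polyBounded_drawTime : PolyBounded (drawTime F) := by
  have hc := fun c => PolyBounded.const c
  have hi := PolyBounded.id
  exact (hc 1).add (((polyBounded_sampleTime F).add (hc 4)).add (polyBounded_restoreTime.add
    ((hc 1).add ((hc 1).add (((hc 2).add ((hc 3).mul hi)).add ((hc 2).add (((hc 1).add hi).add
    (((hi.mul (hc 8)).add (hc 1)).add (hc 3)))))))))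

omit [Fintype T] [DecidableEq T] in
theorem head?_ofTokens_reverse (x : List T) :
    (ofTokens x.reverse).head? = x.getLast?.map Sum.inr := by
  rw [ofTokens, List.head?_map, List.head?_reverse]

/-- The draw leaves the text `x` intact, so it can be repeated; given `x`, the two draws are
independent. -/
theorem Triple.drawToken
    (hF : ∀ q x, ∀ s ∈ (F.run Empty.elim q (ofTokens x)).support, s.output = f q x)
    (hs : Holds F q x s) (hm : (s.regs 0).length + q.length + x.length ≤ m) (c : Bool) :
    Triple P (drawToken done echo F t c) (drawTime F m) s
      (drawLaw done echo f P q (s.regs 0) t c x) fun b s' =>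
      Holds F q x s' ∧ s'.regs 0 = s.regs 0 ∧ s'.regs 8 = [Sum.inl b] := by
  have hs' : Holds F q x (s.tick 1) := ⟨hs.prompt, hs.text, hs.empty, hs.high⟩
  have htest : ∀ (t : T) (x : List T),
      decide ((ofTokens x.reverse).head? = some (Sum.inr t)) = decide (x.getLast? = some t) := by
    intro t x
    rw [head?_ofTokens_reverse]
    cases x.getLast? <;> simp
  refine Triple.ite ?_ ?_
  · intro ht
    rw [hs.text, htest, decide_eq_true_eq] at ht
    rw [drawLaw, if_pos ht]
    refine Triple.of_unit ((Triple.setBit hs'.empty _).le (by omega)) _ ?_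
    intro s₁ h1
    refine ⟨⟨?_, ?_, ?_, fun r hr => ?_⟩, ?_, ?_⟩
    · simp [h1, hs.prompt]
    · simp [h1, hs.text]
    · simp [h1, hs.empty]
    · simp [h1, show r ≠ 8 by omega, hs.high r hr]
    · simp [h1]
    · simp [h1]
  · intro ht
    rw [hs.text, htest, decide_eq_false_iff_not] at ht
    rw [drawLaw, if_neg ht]
    cases c
    · simp only [Bool.false_eq_true, if_false]
      refine Triple.le (B₁ := restoreTime T m + (1 + (1 + ((2 + 3 * m) +
        (2 + ((1 + m) + ((m * 8 + 1) + 3))))))) ?_ (by omega)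
      refine Triple.seq_det (Triple.restoreText hs' (by omega)) ?_
      rintro s₁ ⟨h1, h15, h1f, -⟩
      refine Triple.seq_det (Triple.copy _ _ (by simp [h1.empty])) ?_
      rintro s₂ rfl
      refine Triple.seq_det (Triple.push _ _) ?_
      rintro s₃ rfl
      have h10 : s₁.regs 0 = s.regs 0 := h1f 0 (by decide) (by decide)
      have hargs : [1, 5, 9, 0].map ((((s₁.set 9 (s₁.regs 7)).tick
          (1 + (s₁.regs 7).length)).set 9 (Sum.inr t :: ((s₁.set 9 (s₁.regs 7)).tick
          (1 + (s₁.regs 7).length)).regs 9)).tick 1).regs =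
          [q, ofTokens x, [Sum.inr t], s.regs 0] := by
        simp [h1.prompt, h15, h1.empty, h10]
      rw [← hargs]
      refine Triple.seq (Triple.query _ _ _ ?_) ?_
      · simp [h1.prompt, h15, h1.empty, h10]
        omega
      · rintro ans s₄ ⟨h4, -⟩
        have h40 : s₄.regs 0 = s.regs 0 := by simp [h4, h10]
        have := Triple.drawBit (O := P) (s := s₄) (m := m) (by simp [h4, h1.empty])
          (by rw [h40]; omega)
        rw [h40, show s₄.regs 6 = ans by simp [h4]] at this
        refine this.post ?_
        rintro b s₅ ⟨h8, h5⟩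
        have h5' : ∀ r, r ≠ 4 → r ≠ 6 → r ≠ 8 → r ≠ 9 → s₅.regs r = s₁.regs r := by
          intro r g1 g2 g3 g4
          rw [h5 r g1 g2 g3 g4]
          simp [h4, g2, g4]
        refine ⟨⟨?_, ?_, ?_, fun r hr => ?_⟩, ?_, h8⟩
        · simp [h5', h1.prompt]
        · simp [h5', h1.text]
        · simp [h5', h1.empty]
        · rw [h5' r (by omega) (by omega) (by omega) (by omega), h1.high r hr]
        · simp [h5', h10]
    · simp only [if_true]
      refine Triple.le (B₁ := sampleTime F m + 4) ?_ (by omega)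
      -- After sampling, the new token is only visible as the last token of the extended text, so
      -- the event is rewritten in terms of that text.
      have e : ((P .text [f q x]).map (answerToken done echo x)).map (fun t' => decide (t' = t)) =
          ((P .text [f q x]).map fun ans => x ++ [answerToken done echo x ans]).map
            fun x' => decide (x'.getLast? = some t) := by
        rw [PMF.map_comp, PMF.map_comp]
        congr 1
        funext ans
        simp
      rw [e]
      refine Triple.seq_map (Triple.sampleToken echo hF _ hs' (by omega)) ?_
      rintro x' s₁ ⟨h1, h1f, -, t', rfl⟩
      refine Triple.seq_det (B₁ := 3) (B₂ := 1) (R := fun _ s' =>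
        s'.regs = Function.update s₁.regs 8
          [Sum.inl (decide ((x ++ [t']).getLast? = some t))]) ?_ ?_
      · refine Triple.ite (B := 2) ?_ ?_
        · intro hb
          rw [h1.text, htest] at hb
          rw [hb]
          exact Triple.setBit (s := s₁.tick 1) h1.empty _
        · intro hb
          rw [h1.text, htest] at hb
          rw [hb]
          exact Triple.setBit (s := s₁.tick 1) h1.empty _
      · intro s₂ h2
        -- Removing the sampled token restores `x`.
        refine (Triple.pop _).post ?_
        rintro _ s₃ rfl
        refine ⟨⟨?_, ?_, ?_, fun r hr => ?_⟩, ?_, ?_⟩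
        · simp [h2, h1.prompt]
        · simp [h2, h1.text, ofTokens]
        · simp [h2, h1.empty]
        · simp [h2, show r ≠ 8 by omega, show r ≠ 3 by omega, h1.high r hr]
        · simp [h2, h1f]
        · simp [h2]

/-- Push a string to register `1`. -/
def pushString (ι : Type v) : List (Sym T) → Prog (Sym T) ι
  | [] => .skip
  | a :: l => .seq (pushString ι l) (.push 1 a)

omit [Fintype T] [DecidableEq T] in
theorem Triple.pushString (l : List (Sym T)) :
    Triple O (pushString ι l) (l.length + 1) s (PMF.pure ()) fun _ s' =>
      s'.regs = Function.update s.regs 1 (l ++ s.regs 1) := by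
  induction l with
  | nil =>
    refine Triple.skip.post ?_
    rintro _ s' rfl
    simp
  | cons a l ih =>
    refine Triple.seq_det ih ?_
    intro s₁ h1
    refine (Triple.push _ _).post ?_
    rintro _ s₂ rfl
    funext r
    simp only [State.regs_tick, State.regs_set, h1, Function.update_apply]
    split_ifs <;> simp_all

/-- Move the leading ones of register `1` to register `2`, and remove the next symbol. -/
def decode (T : Type u) (ι : Type v) : Prog (Sym T) ι :=
  .seq (.while 1 isOne (.seq (.pop 1) (.push 2 (Sum.inl true)))) (.pop 1)

omit [Fintype T] [DecidableEq T] in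
theorem Triple.decode (h2 : s.regs 2 = []) (hm : (s.regs 1).length ≤ m) :
    Triple O (decode T ι) ((m * 3 + 1) + 1) s (PMF.pure ()) fun _ s' =>
      s'.regs 1 = ((s.regs 1).dropWhile fun a => isOne (some a)).tail ∧
      (s'.regs 2).length = ((s.regs 1).takeWhile fun a => isOne (some a)).length ∧
      ∀ r, r ≠ 1 → r ≠ 2 → s'.regs r = s.regs r := by
  refine Triple.seq_det (R := fun _ s' =>
      s'.regs 1 = ((s.regs 1).dropWhile fun a => isOne (some a)) ∧
      (s'.regs 2).length = ((s.regs 1).takeWhile fun a => isOne (some a)).length ∧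
      ∀ r, r ≠ 1 → r ≠ 2 → s'.regs r = s.regs r) ?_ ?_
  · have := Triple.while_det (O := O) (r := 1) (test := isOne)
      (p := .seq (.pop 1) (.push 2 (Sum.inl true))) (B := 2)
      (R := fun s' => s'.regs 1 = ((s.regs 1).dropWhile fun a => isOne (some a)) ∧
        (s'.regs 2).length = ((s.regs 1).takeWhile fun a => isOne (some a)).length ∧
        ∀ r, r ≠ 1 → r ≠ 2 → s'.regs r = s.regs r)
      (Inv := fun k s' => ((s'.regs 1).takeWhile fun a => isOne (some a)).length = k ∧
        ((s'.regs 1).dropWhile fun a => isOne (some a)) =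
          ((s.regs 1).dropWhile fun a => isOne (some a)) ∧
        (s'.regs 2).length + k = ((s.regs 1).takeWhile fun a => isOne (some a)).length ∧
        ∀ r, r ≠ 1 → r ≠ 2 → s'.regs r = s.regs r)
      ?_ ?_ ?_ _ s ⟨rfl, rfl, by simp [h2], fun _ _ _ => rfl⟩
    · refine this.le ?_
      gcongr
      exact (List.takeWhile_sublist _).length_le.trans hm
    · rintro k s' ⟨rfl, -⟩
      cases s'.regs 1 with
      | nil => simp [isOne]
      | cons a l => cases h : isOne (some a) <;> simp [h]
    · rintro k s' ⟨g1, g2, g3, g4⟩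
      refine Triple.seq_det (B₁ := 1) (B₂ := 1) (Triple.pop _) ?_
      rintro s₁ rfl
      refine (Triple.push _ _).post ?_
      rintro _ s₂ rfl
      obtain ⟨a, l, hl, ha⟩ : ∃ a l, s'.regs 1 = a :: l ∧ isOne (some a) = true := by
        cases hl : s'.regs 1 with
        | nil => simp [hl] at g1
        | cons a l =>
          refine ⟨a, l, rfl, ?_⟩
          by_contra ha
          simp [hl, ha] at g1
      rw [hl] at g1 g2
      simp only [List.takeWhile_cons, List.dropWhile_cons, ha, if_true] at g1 g2
      refine ⟨by simpa [hl] using g1, by simpa [hl] using g2, ?_, ?_⟩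
      · simp
        omega
      · intro r k1 k2
        simp [k1, k2, g4 r k1 k2]
    · rintro s' ⟨g1, g2, g3, g4⟩
      refine ⟨?_, by simpa using g3, g4⟩
      rw [← g2, State.regs_tick]
      rw [List.length_eq_zero_iff, List.takeWhile_eq_nil_iff] at g1
      cases hl : s'.regs 1 with
      | nil => rfl
      | cons a l =>
        have : isOne (some a) = false := by simpa [hl] using g1
        simp [this]
  · rintro s₁ ⟨g1, g2, g3⟩
    refine (Triple.pop _).post ?_
    rintro _ s₂ rfl
    refine ⟨by simp [g1], by simp [g2], ?_⟩
    intro r k1 k2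
    simp [k1, g3 r k1 k2]

variable (done echo F) in
/-- The program of the distinguisher. -/
def distProg (z₀ : List (Sym T)) (t : T) (c₁ c₂ : Bool) : Prog (Sym T) DistOracle :=
  .seq (pushString _ z₀) (.seq (decode T _) (.seq (sampleText done echo F .text)
    (.seq (drawToken done echo F t c₁) (.seq (.ite 8 isOne (drawToken done echo F t c₂) .skip)
      (.copy 8 0)))))

/-- The law of the output bit of the distinguisher. -/
def testLaw (L₁ L₂ : List T → PMF Bool) (x : List T) : PMF Bool :=
  (L₁ x).bind fun b => if b then L₂ x else PMF.pure false

/-- A bound of the running time of the distinguisher. -/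
def distTime (F : PolyTimeProg (Sym T) Empty) (k : ℕ) (m : ℕ) : ℕ :=
  (k + 1) + (((m * 3 + 1) + 1) + ((m * (sampleTime F m + 3) + 1) +
    (drawTime F m + ((1 + drawTime F m) + 2))))

omit [DecidableEq T] in
theorem polyBounded_distTime (k : ℕ) : PolyBounded (distTime F k) := by
  have hc := fun c => PolyBounded.const c
  have hi := PolyBounded.id
  exact ((hc k).add (hc 1)).add ((((hi.mul (hc 3)).add (hc 1)).add (hc 1)).add
    (((hi.mul ((polyBounded_sampleTime F).add (hc 3))).add (hc 1)).add
    (polyBounded_drawTime.add (((hc 1).add polyBounded_drawTime).add (hc 2)))))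

/-- The position and the prompt are decoded from `z₀ ++ y`, where `z₀` is part of the program and
`y` is an input. This covers hardwired data (`y` empty) and advice (`z₀` empty) with one program. -/
theorem Triple.distProg
    (hF : ∀ q x, ∀ s ∈ (F.run Empty.elim q (ofTokens x)).support, s.output = f q x)
    (c₁ c₂ : Bool) (a z : List (Sym T)) (hz : z₀ ++ y = z) :
    Triple P (distProg done echo F z₀ t c₁ c₂)
      (distTime F z₀.length (a.length + y.length + z₀.length)) (State.init a y)
      ((generate done (fun x => (P .text [f (z.dropWhile fun a => isOne (some a)).tail x]).map
          (answerToken done echo x)) (z.takeWhile fun a => isOne (some a)).length []).bind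
        (testLaw (drawLaw done echo f P (z.dropWhile fun a => isOne (some a)).tail a t c₁)
          (drawLaw done echo f P (z.dropWhile fun a => isOne (some a)).tail a t c₂)))
      fun b s' => s'.regs 0 = [Sum.inl b] := by
  set m := a.length + y.length + z₀.length with hm
  set q := (z.dropWhile fun a => isOne (some a)).tail with hq
  set i := (z.takeWhile fun a => isOne (some a)).length with hi
  have hzl : z.length = z₀.length + y.length := by simp [← hz]
  have hqi : q.length + i ≤ z.length := by
    have := congrArg List.length (List.takeWhile_append_dropWhile (p := fun a => isOne (some a))
      (l := z))
    simp only [List.length_append] at this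
    simp only [hq, hi, List.length_tail]
    omega
  have h0 := Holds.init F a y
  refine Triple.seq_det (Triple.pushString z₀) ?_
  intro s₁ h1
  have h11 : s₁.regs 1 = z := by simp [h1, ← hz, State.init]
  refine Triple.seq_det (Triple.decode (by simp [h1, State.init]) (m := m)
    (by rw [h11]; omega)) ?_
  rintro s₂ ⟨h2, h22, h2f⟩
  rw [h11] at h2 h22
  have hh : Holds F q [] s₂ := by
    refine ⟨h2, ?_, ?_, fun r hr => ?_⟩
    · rw [h2f 3 (by decide) (by decide), h1, Function.update_of_ne (by decide), h0.text]
    · rw [h2f 7 (by decide) (by decide), h1, Function.update_of_ne (by decide), h0.empty]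
    · rw [h2f r (by omega) (by omega), h1, Function.update_of_ne (by omega), h0.high r hr]
  have h20 : s₂.regs 0 = a := by
    rw [h2f 0 (by decide) (by decide), h1, Function.update_of_ne (by decide)]
    rfl
  refine Triple.seq (Triple.sampleText echo hF _ hh h22 (by omega)) ?_
  rintro x s₃ ⟨h3, h3l, h3f, -⟩
  have h30 : s₃.regs 0 = a := by rw [h3f 0 (by simp), h20]
  have hlen : a.length + q.length + x.length ≤ m := by omega
  have hd := Triple.drawToken (P := P) (done := done) (echo := echo) (t := t) hF h3 (m := m)
    (by rw [h30]; exact hlen) c₁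
  rw [h30] at hd
  refine Triple.seq hd ?_
  rintro b s₄ ⟨h4, h40, h48⟩
  -- Brings the law into the shape that `seq_map` expects; the last instruction only copies the bit.
  rw [← PMF.map_id (if b = true then _ else _)]
  refine Triple.seq_map (B₁ := 1 + drawTime F m) (B₂ := 2)
    (R := fun b s' => s'.regs 8 = [Sum.inl b]) ?_ ?_
  · refine Triple.ite ?_ ?_
    · intro hb
      have hb' : b = true := by
        rw [h48] at hb
        cases b <;> simp_all [isOne]
      rw [if_pos hb']
      have h4' : Holds F q x (s₄.tick 1) := ⟨h4.prompt, h4.text, h4.empty, h4.high⟩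
      have hd := Triple.drawToken (P := P) (done := done) (echo := echo) (t := t) hF h4' (m := m)
        (by rw [State.regs_tick, h40]; exact hlen) c₂
      rw [State.regs_tick, h40] at hd
      exact hd.post fun _ _ h => h.2.2
    · intro hb
      have hb' : b = false := by
        rw [h48] at hb
        cases b <;> simp_all [isOne]
      subst hb'
      rw [if_neg (by decide)]
      refine Triple.of_unit (Triple.skip.le ?_) _ ?_
      · simp only [drawTime]; omega
      · rintro s₅ rfl
        simpa using h48
  · rintro b s₅ h5
    refine (Triple.copy _ _ (by simp [h5])).post ?_
    rintro _ s₆ rfl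
    simp [h5]

/-- The encoding of a number and a string. -/
def encode (i : ℕ) (q : Prompt T) : List (Sym T) := unary T i ++ Sum.inl false :: q

omit [Fintype T] [DecidableEq T] in
theorem takeWhile_encode (i : ℕ) (q : Prompt T) :
    ((encode i q).takeWhile fun a => isOne (some a)).length = i := by
  rw [encode, List.takeWhile_append_of_pos]
  · simp [unary, isOne]
  · intro a ha
    rw [List.eq_of_mem_replicate ha]
    rfl

omit [Fintype T] [DecidableEq T] in
theorem dropWhile_encode (i : ℕ) (q : Prompt T) :
    ((encode i q).dropWhile fun a => isOne (some a)).tail = q := by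
  rw [encode, List.dropWhile_append_of_pos]
  · simp [isOne]
  · intro a ha
    rw [List.eq_of_mem_replicate ha]
    rfl

variable (done) in
/-- Unless the text ends in `done`, the event that the next token is `t`, where the law of the next
token is `S` if `c = true` and `p`, rounded to `n` binary digits, if `c = false`. -/
def pickLaw (S p : List T → PMF T) (n : ℕ) (t : T) (c : Bool) (x : List T) : PMF Bool :=
  if x.getLast? = some done then PMF.pure false
  else if c then (S x).map fun t' => decide (t' = t)
  else bitLaw n ((Nat.bits ⌊2 ^ n * (p x t).toReal⌋₊).map (Sum.inl : Bool → Sym T))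

variable (done) in
/-- The law of the output bit of the distinguisher in terms of the laws of the next token. -/
def distLaw (S p : List T → PMF T) (n i : ℕ) (t : T) (c₁ c₂ : Bool) : PMF Bool :=
  (generate done S i []).bind (testLaw (pickLaw done S p n t c₁) (pickLaw done S p n t c₂))

/-- The order of quantifiers matters: `D` depends only on `z₀`, `t` and the kinds of the two draws,
and serves all `n`, `i`, `q` and both oracles. -/
theorem exists_distinguisher
    (hF : ∀ q x, ∀ s ∈ (F.run Empty.elim q (ofTokens x)).support, s.output = f q x)
    (z₀ : List (Sym T)) (t : T) (c₁ c₂ : Bool) :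
    ∃ D : PolyTimeProg (Sym T) DistOracle, ∀ (next : Prompt T → List T → PMF T)
      (w : Prompt T → PMF (List T)) (n i : ℕ) (q : Prompt T) (y : List (Sym T)),
      z₀ ++ y = encode i q → decision D n y next w =
        distLaw done (stepLaw done echo f w q) (next q) n i t c₁ c₂ := by
  have key := fun P (a y : List (Sym T)) =>
    Triple.distProg (P := P) (done := done) (echo := echo) (t := t) hF c₁ c₂ a _ (rfl : z₀ ++ y = _)
  obtain ⟨D, hD⟩ := exists_polyTimeProg _ (B := fun m => distTime F z₀.length (m + z₀.length))
    ((polyBounded_distTime _).comp (PolyBounded.id.add (PolyBounded.const _))) key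
  refine ⟨D, fun next w n i q y hz => ?_⟩
  obtain ⟨ν, h1, h2, h3⟩ := hD (distOracles next w) (unary T n) y
  rw [hz, takeWhile_encode, dropWhile_encode] at h2
  have h4 : ∀ c, drawLaw done echo f (distOracles next w) q (unary T n) t c =
      pickLaw done (stepLaw done echo f w q) (next q) n t c := by
    intro c
    funext x
    simp only [drawLaw, pickLaw, distOracles, map_textOracle]
    congr 2
    -- The precision of the query is the input `1^n` itself, hence rounding to `n` digits.
    simp [modelOracle, tokens, unary, PMF.pure_bind]
    rw [← tokens, tokens_ofTokens]
  simp only [distOracles, map_textOracle] at h2 h4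
  simp only [h4] at h2
  rw [distLaw, ← h2, decision, h1, PMF.map_comp]
  refine map_congr_support fun z hz => ?_
  simp only [Function.comp, State.output, h3 z hz]
  cases z.1 <;> rfl

end Distinguish

section Generate

variable {T : Type u} [DecidableEq T] {done : T} {p p' : List T → PMF T} {x y : List T}

/-! ## The law of generated texts -/

theorem generate_of_stop (h : x.getLast? = some done) (n : ℕ) :
    generate done p n x = PMF.pure x := by
  cases n <;> simp [generate, h]

theorem generate_add (a b : ℕ) (x : List T) :
    generate done p (a + b) x = (generate done p a x).bind (generate done p b) := by
  induction a generalizing x with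
  | zero => simp [generate, PMF.pure_bind]
  | succ a ih =>
    by_cases h : x.getLast? = some done
    · simp [generate_of_stop h, PMF.pure_bind]
    · rw [show a + 1 + b = (a + b) + 1 by omega]
      simp [generate, h, PMF.bind_bind, ih]

theorem generate_support {n : ℕ} (h : y ∈ (generate done p n x).support) :
    x <+: y ∧ (y.getLast? = some done ∨ y.length = x.length + n) ∧
      y.length ≤ x.length + n := by
  induction n generalizing x with
  | zero =>
    simp only [generate, PMF.mem_support_pure_iff] at h
    subst h
    simp
  | succ n ih =>
    by_cases hx : x.getLast? = some done
    · rw [generate_of_stop hx, PMF.mem_support_pure_iff] at h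
      subst h
      simp [hx]
    · simp only [generate, hx, if_false, PMF.mem_support_bind_iff] at h
      obtain ⟨t, -, h⟩ := h
      obtain ⟨h1, h2, h3⟩ := ih h
      simp only [List.length_append, List.length_singleton] at h2 h3
      refine ⟨(List.prefix_append _ _).trans h1, ?_, by omega⟩
      rcases h2 with h2 | h2
      · exact Or.inl h2
      · right; omega

/-- Generation stops at `done`, so this token can only come last. Prefix-specifiability speaks only
of texts without `done`. -/
theorem notMem_of_generate {n : ℕ} (h : y ∈ (generate done p n x).support) (hx : done ∉ x)
    (hy : y.getLast? ≠ some done) : done ∉ y := by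
  induction n generalizing x with
  | zero =>
    simp only [generate, PMF.mem_support_pure_iff] at h
    rwa [h]
  | succ n ih =>
    by_cases hl : x.getLast? = some done
    · exact absurd (List.mem_of_getLast? hl) hx
    · simp only [generate, hl, if_false, PMF.mem_support_bind_iff] at h
      obtain ⟨t, -, h⟩ := h
      by_cases ht : t = done
      · subst ht
        rw [generate_of_stop (by simp), PMF.mem_support_pure_iff] at h
        subst h
        simp at hy
      · refine ih h ?_
        simp only [List.mem_append, List.mem_singleton, not_or]
        exact ⟨hx, fun h => ht h.symm⟩

/-- Only the laws at reachable unfinished texts matter. The induction splits off the last token, so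
that the prefix `x` stays fixed. -/
theorem generate_congr (n : ℕ) (h : ∀ i, ∀ y ∈ (generate done p i x).support,
    y.getLast? ≠ some done → p y = p' y) : generate done p n x = generate done p' n x := by
  induction n with
  | zero => rfl
  | succ n ih =>
    rw [generate_add, generate_add, ← ih]
    refine bind_congr_support fun y hy => ?_
    by_cases hl : y.getLast? = some done
    · rw [generate_of_stop hl, generate_of_stop hl]
    · simp [generate, hl, h n y hy hl]

namespace LanguageModel

variable {M : LanguageModel T done} {q : Prompt T}

theorem generate_eq_response {n : ℕ} (h : M.bound.eval q.length ≤ n) :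
    generate done (M.next q) n [] = M.response q := by
  obtain ⟨b, rfl⟩ := Nat.exists_eq_add_of_le h
  rw [generate_add, response]
  conv_rhs => rw [← PMF.bind_pure (generate done (M.next q) _ [])]
  exact bind_congr_support fun y hy => generate_of_stop (M.terminates q y hy) b

/-- A reachable text that does not end in `done` can be continued. -/
theorem lt_bound {i : ℕ} (h : x ∈ (generate done (M.next q) i []).support)
    (hx : x.getLast? ≠ some done) : i < M.bound.eval q.length := by
  by_contra hi
  rw [generate_eq_response (not_lt.1 hi)] at h
  exact hx (M.terminates q x h)

/-- The conditioned response is generated from the given prefix. -/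
theorem filter_response {i : ℕ} (h : x ∈ (generate done (M.next q) i []).support)
    (hx : x.getLast? ≠ some done)
    (hr : ∃ r ∈ {r : List T | x <+: r}, r ∈ (M.response q).support) :
    (M.response q).filter {r | x <+: r} hr =
      generate done (M.next q) (M.bound.eval q.length - i) x := by
  have hi := lt_bound h hx
  have hlen : x.length = i := by
    have := (generate_support h).2.1
    simpa [hx] using this
  set j := M.bound.eval q.length - i
  have hresp : M.response q =
      (generate done (M.next q) i []).bind (generate done (M.next q) j) := by
    rw [← generate_add, response]
    congr 1
    omega
  -- A response that extends `x` is obtained by reaching `x` after `i` tokens and continuing from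
  -- there, and in no other way.
  have hind : ∀ r, ({r : List T | x <+: r} : Set (List T)).indicator (M.response q) r =
      generate done (M.next q) i [] x * generate done (M.next q) j x r := by
    intro r
    by_cases hxr : x <+: r
    · rw [Set.indicator_of_mem (by exact hxr), hresp, PMF.bind_apply, tsum_eq_single x]
      intro y hy
      by_contra h0
      rw [mul_eq_zero, not_or] at h0
      have hy1 := generate_support ((PMF.mem_support_iff _ _).2 h0.1)
      have hy2 := (generate_support ((PMF.mem_support_iff _ _).2 h0.2)).1
      simp only [List.length_nil, zero_add] at hy1
      -- Another intermediate text `y` either has length `i`, and then it equals `x` as a prefix of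
      -- `r`, or it stopped earlier, and then `r = y` is too short to extend `x`.
      by_cases hyl : y.length = i
      · exact hy ((List.prefix_of_prefix_length_le hy2 hxr (by omega)).eq_of_length (by omega))
      · have hd : y.getLast? = some done := by simpa [hyl] using hy1.2.1
        have h2 := h0.2
        rw [generate_of_stop hd] at h2
        have : r = y := by simpa [PMF.pure_apply] using h2
        have := hxr.length_le
        have := hy1.2.2
        subst r
        omega
    · rw [Set.indicator_of_notMem (by exact hxr)]
      symm
      rw [mul_eq_zero]
      right
      by_contra h0
      exact hxr (generate_support ((PMF.mem_support_iff _ _).2 h0)).1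
  ext r
  rw [PMF.filter_apply]
  simp only [hind]
  -- The normalizing constant of the conditioning is the probability of reaching `x`.
  rw [ENNReal.tsum_mul_left, PMF.tsum_coe, mul_one, mul_comm, ← mul_assoc,
    ENNReal.inv_mul_cancel ((PMF.mem_support_iff _ _).1 h) (PMF.apply_ne_top _ _), one_mul]

/-- The conditioned response is generated from `x` and at least one token is still to come, so its
first token after `x` is a draw from `M.next q x`. The default `done` in `stepLaw` is never used
here, and both conventions give the same token. -/
theorem stepLaw_response {echo : Bool} {f : Prompt T → List T → Prompt T}
    (hf : ∀ (q : Prompt T) (x : List T), done ∉ x →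
      ∀ h : ∃ r ∈ {r : List T | x <+: r}, r ∈ (M.response q).support,
        M.response (f q x) =
          ((M.response q).filter {r | x <+: r} h).map
            fun r => if echo then r else r.drop x.length)
    {i : ℕ} (h : x ∈ (generate done (M.next q) i []).support)
    (hx : x.getLast? ≠ some done) :
    stepLaw done echo f M.response q x = M.next q x := by
  have hi := lt_bound h hx
  obtain ⟨j, hj⟩ : ∃ j, M.bound.eval q.length - i = j + 1 :=
    ⟨M.bound.eval q.length - i - 1, by omega⟩
  have hr : ∃ r ∈ {r : List T | x <+: r}, r ∈ (M.response q).support := by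
    obtain ⟨r, hr⟩ := (generate done (M.next q) (j + 1) x).support_nonempty
    refine ⟨r, (generate_support hr).1, ?_⟩
    rw [response, show M.bound.eval q.length = i + (j + 1) by omega, generate_add,
      PMF.mem_support_bind_iff]
    exact ⟨x, h, hr⟩
  rw [stepLaw, hf q x (notMem_of_generate h (by simp) hx) hr, filter_response h hx hr, hj,
    PMF.map_comp]
  simp only [generate, hx, if_false, PMF.map_bind]
  conv_rhs => rw [← PMF.bind_pure (M.next q x)]
  congr 1
  funext t
  rw [← PMF.map_const (generate done (M.next q) j (x ++ [t])) t]
  refine map_congr_support fun r hr => ?_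
  obtain ⟨l, rfl⟩ := (generate_support hr).1
  cases echo <;> simp

end LanguageModel

end Generate

/-! ## Probabilities as real numbers -/

theorem toReal_bind_apply {α : Type*} {β : Type*} (μ : PMF α) (g : α → PMF β) (b : β) :
    (μ.bind g b).toReal = ∑' a, (μ a).toReal * (g a b).toReal := by
  rw [PMF.bind_apply, ENNReal.tsum_toReal_eq fun a =>
    ENNReal.mul_ne_top (PMF.apply_ne_top _ _) (PMF.apply_ne_top _ _)]
  simp only [ENNReal.toReal_mul]

theorem toReal_bind_apply_fintype {α : Type*} {β : Type*} [Fintype α] (μ : PMF α) (g : α → PMF β)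
    (b : β) : (μ.bind g b).toReal = ∑ a, (μ a).toReal * (g a b).toReal := by
  rw [toReal_bind_apply, tsum_fintype]

theorem summable_toReal {α : Type*} (μ : PMF α) : Summable fun a => (μ a).toReal :=
  ENNReal.summable_toReal μ.tsum_coe_ne_top

theorem tsum_toReal {α : Type*} (μ : PMF α) : ∑' a, (μ a).toReal = 1 := by
  rw [← ENNReal.tsum_toReal_eq (PMF.apply_ne_top μ), PMF.tsum_coe, ENNReal.toReal_one]

theorem toReal_apply_le_one {α : Type*} (μ : PMF α) (a : α) : (μ a).toReal ≤ 1 := by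
  have := ENNReal.toReal_mono ENNReal.one_ne_top (μ.coe_le_one a)
  simpa using this

theorem toReal_pure_apply {α : Type*} [DecidableEq α] (a b : α) :
    (PMF.pure a b).toReal = if b = a then 1 else 0 := by
  rw [PMF.pure_apply]
  split_ifs <;> simp

theorem toReal_uniform_bind {β : Type*} (g : Bool → PMF β) (b : β) :
    (((PMF.uniformOfFintype Bool).bind g) b).toReal =
      ((g true b).toReal + (g false b).toReal) / 2 := by
  rw [toReal_bind_apply_fintype]
  simp
  ring

/-! ### Exactness of the bit sampler -/

section Bits

variable {T : Type u}

/-- The string of the binary digits of `a`. -/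
abbrev bitString (T : Type u) (a : ℕ) : List (Sym T) := (Nat.bits a).map Sum.inl

theorem headBit_bitString (a : ℕ) : headBit (bitString T a) = a.bodd := by
  induction a using Nat.binaryRec' with
  | zero => rfl
  | bit b n h =>
    rw [bitString, Nat.bits_append_bit n b h]
    cases b <;> simp [headBit]

theorem tail_bitString (a : ℕ) : (bitString T a).tail = bitString T a.div2 := by
  induction a using Nat.binaryRec' with
  | zero => rfl
  | bit b n h =>
    rw [bitString, Nat.bits_append_bit n b h]
    simp

/-- Later digits overwrite earlier ones, which gives them their larger weight. The initial bit `v`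
survives when no coin replaces it, with probability 2^-k; for `a = 2 ^ k` the remaining digit makes
the outcome `true` anyway, so `v` then adds nothing. -/
theorem toReal_iterUntil_coinStep (k : ℕ) : ∀ (a : ℕ) (v : Bool), a ≤ 2 ^ k →
    (((iterUntil coinStep (fun _ => false) k (v, bitString T a)).map
      fun a => headBit a.2 || a.1) true).toReal * 2 ^ k =
      a + if v = true ∧ a < 2 ^ k then 1 else 0 := by
  induction k with
  | zero =>
    intro a v ha
    simp only [iterUntil, PMF.pure_map, headBit_bitString, toReal_pure_apply]
    simp only [pow_zero] at ha ⊢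
    interval_cases a <;> cases v <;> simp
  | succ k ih =>
    intro a v ha
    have h2 := Nat.bodd_add_div2 a
    have hd : a.div2 ≤ 2 ^ k := by rw [pow_succ] at ha; omega
    have hd' : a.div2 < 2 ^ k ↔ a < 2 ^ (k + 1) := by
      rw [pow_succ] at ha ⊢
      cases h : a.bodd <;> simp only [h, Bool.toNat_true, Bool.toNat_false] at h2 <;> omega
    have h3 : (a : ℝ) = (if a.bodd then 1 else 0) + 2 * a.div2 := by
      conv_lhs => rw [← h2]
      cases a.bodd <;> simp
    have ht := ih a.div2 a.bodd hd
    have hv := ih a.div2 v hd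
    simp only [iterUntil, Bool.false_eq_true, if_false, PMF.map_bind, coinStep, PMF.bind_map,
      Function.comp_def, headBit_bitString, tail_bitString]
    rw [toReal_uniform_bind, pow_succ]
    simp only [if_true, Bool.false_eq_true, if_false, ← hd', ← pow_succ] at ht hv ⊢
    rw [pow_succ]
    -- An odd `a ≤ 2 ^ (k + 1)` is strictly smaller, so the side condition is automatic.
    have h4 : ((if a.bodd = true ∧ a.div2 < 2 ^ k then (1 : ℝ) else 0)) =
        if a.bodd then 1 else 0 := by
      cases h : a.bodd
      · simp
      · have : a.div2 < 2 ^ k := by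
          rw [pow_succ] at ha
          simp only [h, Bool.toNat_true] at h2
          omega
        simp [this]
    rw [h4] at ht
    linarith

/-- The case `a = 2 ^ k` is included because a token may have probability one. -/
theorem toReal_bitLaw {k a : ℕ} (h : a ≤ 2 ^ k) :
    (bitLaw k (bitString T a) true).toReal = a / 2 ^ k := by
  have := toReal_iterUntil_coinStep (T := T) k a false h
  rw [eq_div_iff (by positivity), bitLaw, this]
  simp

end Bits

/-! ## Expectations -/

section Expect

variable {α : Type*} {μ : PMF α} {f g : α → ℝ}

/-- The expectation of a bounded function. -/
def expect (μ : PMF α) (f : α → ℝ) : ℝ := ∑' a, (μ a).toReal * f a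

/-- Bounded functions. -/
def IsBounded (f : α → ℝ) : Prop := ∃ C, ∀ a, |f a| ≤ C

theorem IsBounded.of_le_one (h0 : ∀ a, 0 ≤ f a) {C : ℝ} (h : ∀ a, f a ≤ C) : IsBounded f :=
  ⟨C, fun a => by rw [abs_of_nonneg (h0 a)]; exact h a⟩

theorem IsBounded.add (hf : IsBounded f) (hg : IsBounded g) : IsBounded fun a => f a + g a := by
  obtain ⟨C, hC⟩ := hf
  obtain ⟨D, hD⟩ := hg
  exact ⟨C + D, fun a => (abs_add_le _ _).trans (add_le_add (hC a) (hD a))⟩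

theorem IsBounded.const_mul (hf : IsBounded f) (c : ℝ) : IsBounded fun a => c * f a := by
  obtain ⟨C, hC⟩ := hf
  exact ⟨|c| * C, fun a => by rw [abs_mul]; gcongr; exact hC a⟩

theorem IsBounded.const (c : ℝ) : IsBounded fun _ : α => c := ⟨|c|, fun _ => le_rfl⟩

theorem IsBounded.sum {κ : Type*} {s : Finset κ} {F : κ → α → ℝ}
    (h : ∀ i ∈ s, IsBounded (F i)) : IsBounded fun a => ∑ i ∈ s, F i a := by
  classical
  induction s using Finset.induction_on with
  | empty => simpa using IsBounded.const 0
  | insert i s hi ih =>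
    simp only [Finset.sum_insert hi]
    exact (h i (Finset.mem_insert_self _ _)).add
      (ih fun j hj => h j (Finset.mem_insert_of_mem hj))

theorem IsBounded.summable (hf : IsBounded f) : Summable fun a => (μ a).toReal * f a := by
  obtain ⟨C, hC⟩ := hf
  refine Summable.of_norm_bounded ((summable_toReal μ).mul_right C) fun a => ?_
  rw [Real.norm_eq_abs, abs_mul, abs_of_nonneg ENNReal.toReal_nonneg]
  gcongr
  exact hC a

theorem expect_const (c : ℝ) : expect μ (fun _ => c) = c := by
  rw [expect, tsum_mul_right, tsum_toReal, one_mul]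

theorem expect_add (hf : IsBounded f) (hg : IsBounded g) :
    expect μ (fun a => f a + g a) = expect μ f + expect μ g := by
  simp only [expect, mul_add]
  exact hf.summable.tsum_add hg.summable

theorem expect_const_mul (c : ℝ) : expect μ (fun a => c * f a) = c * expect μ f := by
  rw [expect, expect, ← tsum_mul_left]
  congr 1
  funext a
  ring

theorem expect_sum {κ : Type*} {s : Finset κ} {F : κ → α → ℝ} (h : ∀ i ∈ s, IsBounded (F i)) :
    expect μ (fun a => ∑ i ∈ s, F i a) = ∑ i ∈ s, expect μ (F i) := by
  simp only [expect, Finset.mul_sum]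
  exact Summable.tsum_finsetSum fun i hi => (h i hi).summable

theorem expect_mono (hf : IsBounded f) (hg : IsBounded g) (h : ∀ a, f a ≤ g a) :
    expect μ f ≤ expect μ g :=
  hf.summable.tsum_le_tsum (fun a => mul_le_mul_of_nonneg_left (h a) ENNReal.toReal_nonneg)
    hg.summable

theorem expect_nonneg (h : ∀ a, 0 ≤ f a) : 0 ≤ expect μ f :=
  tsum_nonneg fun a => mul_nonneg ENNReal.toReal_nonneg (h a)

/-- Nonnegativity of the variance. -/
theorem sq_expect_le (hf : IsBounded f) : expect μ f ^ 2 ≤ expect μ fun a => f a ^ 2 := by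
  obtain ⟨C, hC⟩ := id hf
  have h2 : IsBounded fun a => f a ^ 2 := ⟨C ^ 2, fun a => by
    rw [abs_pow]
    exact pow_le_pow_left₀ (abs_nonneg _) (hC a) 2⟩
  set c := expect μ f with hc
  have h : 0 ≤ expect μ fun a => f a ^ 2 + ((-2 * c) * f a + c ^ 2) :=
    expect_nonneg fun a => by nlinarith [sq_nonneg (f a - c)]
  rw [expect_add h2 ((hf.const_mul _).add (IsBounded.const _)),
    expect_add (hf.const_mul _) (IsBounded.const _), expect_const_mul, expect_const, ← hc] at h
  nlinarith

end Expect

/-! ## Distances -/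

section Distance

variable {α : Type*} {β : Type*}

/-- Twice the statistical distance. -/
def l1Dist (μ ν : PMF α) : ℝ := ∑' a, |(μ a).toReal - (ν a).toReal|

theorem summable_abs_sub (μ ν : PMF α) : Summable fun a => |(μ a).toReal - (ν a).toReal| :=
  ((summable_toReal μ).sub (summable_toReal ν)).abs

theorem l1Dist_nonneg (μ ν : PMF α) : 0 ≤ l1Dist μ ν := tsum_nonneg fun _ => abs_nonneg _

theorem l1Dist_le_two (μ ν : PMF α) : l1Dist μ ν ≤ 2 := by
  have : l1Dist μ ν ≤ ∑' a, ((μ a).toReal + (ν a).toReal) := by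
    refine (summable_abs_sub μ ν).tsum_le_tsum (fun a => ?_)
      ((summable_toReal μ).add (summable_toReal ν))
    have h1 : 0 ≤ (μ a).toReal := ENNReal.toReal_nonneg
    have h2 : 0 ≤ (ν a).toReal := ENNReal.toReal_nonneg
    rw [abs_le]
    constructor <;> linarith
  rw [(summable_toReal μ).tsum_add (summable_toReal ν), tsum_toReal, tsum_toReal] at this
  linarith

/-- The intermediate term is μ(a) g(a)(b): the distances of `f` and `g` are thus averaged over `μ`
alone, which lets the hybrid argument sample prefixes from a single process. -/
theorem l1Dist_bind_le [Fintype α] (μ ν : PMF α) (f g : α → PMF β) :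
    l1Dist (μ.bind f) (ν.bind g) ≤
      ∑ a, |(μ a).toReal - (ν a).toReal| + ∑ a, (μ a).toReal * l1Dist (f a) (g a) := by
  have h1 : ∀ b, |(μ.bind f b).toReal - (ν.bind g b).toReal| ≤
      ∑ a, (|(μ a).toReal - (ν a).toReal| * (g a b).toReal +
        (μ a).toReal * |(f a b).toReal - (g a b).toReal|) := by
    intro b
    rw [toReal_bind_apply_fintype, toReal_bind_apply_fintype, ← Finset.sum_sub_distrib]
    refine (Finset.abs_sum_le_sum_abs _ _).trans (Finset.sum_le_sum fun a _ => ?_)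
    have : (μ a).toReal * (f a b).toReal - (ν a).toReal * (g a b).toReal =
        ((μ a).toReal - (ν a).toReal) * (g a b).toReal +
        (μ a).toReal * ((f a b).toReal - (g a b).toReal) := by ring
    rw [this]
    refine (abs_add_le _ _).trans ?_
    rw [abs_mul, abs_mul, abs_of_nonneg (ENNReal.toReal_nonneg (a := g a b)),
      abs_of_nonneg (ENNReal.toReal_nonneg (a := μ a))]
  have h2 : ∀ a ∈ Finset.univ, Summable fun b =>
      |(μ a).toReal - (ν a).toReal| * (g a b).toReal +
        (μ a).toReal * |(f a b).toReal - (g a b).toReal| := fun a _ =>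
    ((summable_toReal _).mul_left _).add ((summable_abs_sub _ _).mul_left _)
  refine ((summable_abs_sub _ _).tsum_le_tsum h1 (summable_sum h2)).trans ?_
  rw [Summable.tsum_finsetSum h2, ← Finset.sum_add_distrib]
  refine (Finset.sum_congr rfl fun a _ => ?_).le
  rw [((summable_toReal _).mul_left _).tsum_add ((summable_abs_sub _ _).mul_left _),
    tsum_mul_left, tsum_mul_left, tsum_toReal, mul_one, l1Dist]

theorem toReal_bind_map_pair (μ : PMF α) (f : α → PMF β) (a : α) (b : β) :
    ((μ.bind fun a => (f a).map fun b => (a, b)) (a, b)).toReal =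
      (μ a).toReal * (f a b).toReal := by
  rw [PMF.bind_apply, tsum_eq_single a, PMF.map_apply, tsum_eq_single b]
  · simp
  · intro b' hb
    rw [if_neg]
    simpa using hb.symm
  · intro a' ha
    rw [PMF.map_apply, mul_eq_zero]
    right
    simp [ha.symm]

/-- Since the key is part of the outcome and has the same law on both sides, the distance is the
average over keys. -/
theorem statDist_bind_map_pair (μ : PMF α) (f g : α → PMF β) :
    statDist (μ.bind fun a => (f a).map fun b => (a, b))
      (μ.bind fun a => (g a).map fun b => (a, b)) =
      1 / 2 * expect μ fun a => l1Dist (f a) (g a) := by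
  have h := summable_abs_sub (μ.bind fun a => (f a).map fun b => (a, b))
    (μ.bind fun a => (g a).map fun b => (a, b))
  have e : ∀ a b, |((μ.bind fun a => (f a).map fun b => (a, b)) (a, b)).toReal -
      ((μ.bind fun a => (g a).map fun b => (a, b)) (a, b)).toReal| =
      (μ a).toReal * |(f a b).toReal - (g a b).toReal| := by
    intro a b
    rw [toReal_bind_map_pair, toReal_bind_map_pair, ← mul_sub, abs_mul,
      abs_of_nonneg ENNReal.toReal_nonneg]
  rw [statDist, h.tsum_prod, expect]
  simp only [e, tsum_mul_left, l1Dist]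

end Distance

/-! ## Expectations over generated texts -/

section ExpGen

variable {T : Type u} [Fintype T] [DecidableEq T] {done : T} {S p : List T → PMF T}
  {φ ψ : List T → ℝ}

variable (done S) in
/-- The expectation of `φ` over texts that are generated from a given prefix. -/
def expGen (φ : List T → ℝ) : ℕ → List T → ℝ
  | 0, x => φ x
  | k + 1, x => if x.getLast? = some done then φ x
    else ∑ t, (S x t).toReal * expGen φ k (x ++ [t])

theorem toReal_generate_bind {β : Type*} (h : List T → PMF β) (b : β) (k : ℕ) (x : List T) :
    ((generate done S k x).bind h b).toReal = expGen done S (fun y => (h y b).toReal) k x := by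
  induction k generalizing x with
  | zero => simp [generate, expGen, PMF.pure_bind]
  | succ k ih =>
    simp only [generate, expGen]
    split
    · rw [PMF.pure_bind]
    · rw [PMF.bind_bind, toReal_bind_apply_fintype]
      simp only [ih]

omit [DecidableEq T] in
theorem sum_toReal (μ : PMF T) : ∑ t, (μ t).toReal = 1 := by
  rw [← tsum_toReal μ, tsum_fintype]

theorem expGen_const (c : ℝ) (k : ℕ) (x : List T) : expGen done S (fun _ => c) k x = c := by
  induction k generalizing x with
  | zero => rfl
  | succ k ih =>
    simp only [expGen, ih]
    rw [← Finset.sum_mul, sum_toReal, one_mul, ite_self]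

theorem expGen_add (k : ℕ) (x : List T) :
    expGen done S (fun y => φ y + ψ y) k x = expGen done S φ k x + expGen done S ψ k x := by
  induction k generalizing x with
  | zero => rfl
  | succ k ih =>
    simp only [expGen, ih, mul_add, Finset.sum_add_distrib]
    split <;> rfl

theorem expGen_const_mul (c : ℝ) (k : ℕ) (x : List T) :
    expGen done S (fun y => c * φ y) k x = c * expGen done S φ k x := by
  induction k generalizing x with
  | zero => rfl
  | succ k ih =>
    simp only [expGen, ih, mul_ite, Finset.mul_sum]
    refine if_congr Iff.rfl rfl (Finset.sum_congr rfl fun t _ => by ring)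

theorem expGen_sum {κ : Type*} (s : Finset κ) (F : κ → List T → ℝ) (k : ℕ) (x : List T) :
    expGen done S (fun y => ∑ i ∈ s, F i y) k x = ∑ i ∈ s, expGen done S (F i) k x := by
  classical
  induction s using Finset.induction_on with
  | empty => simpa using expGen_const 0 k x
  | insert i s hi ih =>
    simp only [Finset.sum_insert hi]
    rw [expGen_add, ih]

theorem expGen_mono (h : ∀ y, φ y ≤ ψ y) (k : ℕ) (x : List T) :
    expGen done S φ k x ≤ expGen done S ψ k x := by
  induction k generalizing x with
  | zero => exact h x
  | succ k ih =>
    simp only [expGen]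
    split
    · exact h x
    · exact Finset.sum_le_sum fun t _ => mul_le_mul_of_nonneg_left (ih _) ENNReal.toReal_nonneg

theorem expGen_nonneg (h : ∀ y, 0 ≤ φ y) (k : ℕ) (x : List T) : 0 ≤ expGen done S φ k x := by
  rw [← expGen_const (done := done) (S := S) 0 k x]
  exact expGen_mono h k x

theorem sq_expGen_le (k : ℕ) (x : List T) :
    expGen done S φ k x ^ 2 ≤ expGen done S (fun y => φ y ^ 2) k x := by
  set c := expGen done S φ k x with hc
  have h : 0 ≤ expGen done S (fun y => φ y ^ 2 + ((-2 * c) * φ y + c ^ 2)) k x :=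
    expGen_nonneg (fun y => by nlinarith [sq_nonneg (φ y - c)]) k x
  rw [expGen_add, expGen_add, expGen_const_mul, expGen_const, ← hc] at h
  nlinarith

/-- The indicator of texts that do not end in `done`. -/
def unfinished (done : T) (x : List T) : ℝ := if x.getLast? = some done then 0 else 1

omit [Fintype T] in
theorem unfinished_nonneg (x : List T) : 0 ≤ unfinished done x := by
  unfold unfinished; split <;> norm_num

omit [Fintype T] in
theorem unfinished_le_one (x : List T) : unfinished done x ≤ 1 := by
  unfold unfinished; split <;> norm_num

/-- The hybrid argument. Prefixes are averaged over `S`, the law that a distinguisher can sample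
with its text oracle. -/
theorem l1Dist_generate_le (k : ℕ) (x : List T) :
    l1Dist (generate done S k x) (generate done p k x) ≤
      ∑ i ∈ Finset.range k, expGen done S
        (fun y => unfinished done y * ∑ t, |(S y t).toReal - (p y t).toReal|) i x := by
  induction k generalizing x with
  | zero => simp [generate, l1Dist]
  | succ k ih =>
    by_cases hx : x.getLast? = some done
    · rw [generate_of_stop hx, generate_of_stop hx]
      simp only [l1Dist, sub_self, abs_zero, tsum_zero]
      refine Finset.sum_nonneg fun i _ => expGen_nonneg (fun y => ?_) _ _
      exact mul_nonneg (unfinished_nonneg y) (Finset.sum_nonneg fun t _ => abs_nonneg _)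
    · simp only [generate, hx, if_false]
      refine (l1Dist_bind_le _ _ _ _).trans ?_
      rw [Finset.sum_range_succ', add_comm]
      refine add_le_add ?_ ?_
      · simp only [expGen, hx, if_false]
        rw [Finset.sum_comm]
        refine Finset.sum_le_sum fun t _ => ?_
        rw [← Finset.mul_sum]
        exact mul_le_mul_of_nonneg_left (ih _) ENNReal.toReal_nonneg
      · simp [expGen, unfinished, hx]

end ExpGen

/-! ## Negligible functions -/

section Negligible

open Filter Topology

variable {f g : ℕ → ℝ}

theorem Negligible.of_le (hf : Negligible f) (h0 : ∀ n, 0 ≤ g n) (h : ∀ n, g n ≤ f n) :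
    Negligible g :=
  Asymptotics.SuperpolynomialDecay.trans_abs_le hf fun n => by
    rw [abs_of_nonneg (h0 n)]
    exact (h n).trans (le_abs_self _)

theorem Negligible.sqrt (hf : Negligible f) : Negligible fun n => √(f n) := by
  intro c
  -- Decay at exponent `2 * c` becomes decay at exponent `c` under the root.
  have h := (Real.continuous_sqrt.tendsto 0).comp (hf (2 * c))
  rw [Real.sqrt_zero] at h
  refine h.congr fun n => ?_
  rw [Function.comp, Real.sqrt_mul (by positivity), mul_comm 2 c, pow_mul,
    Real.sqrt_sq (by positivity)]

theorem Negligible.sum {κ : Type*} {s : Finset κ} {F : κ → ℕ → ℝ}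
    (h : ∀ i ∈ s, Negligible (F i)) : Negligible fun n => ∑ i ∈ s, F i n := by
  classical
  induction s using Finset.induction_on with
  | empty =>
    simp only [Finset.sum_empty]
    exact Asymptotics.superpolynomialDecay_zero _ _
  | insert i s hi ih =>
    simp only [Finset.sum_insert hi]
    exact Asymptotics.SuperpolynomialDecay.add (h i (Finset.mem_insert_self _ _))
      (ih fun j hj => h j (Finset.mem_insert_of_mem hj))

theorem Negligible.polynomial_mul (hf : Negligible f) (P : Polynomial ℕ) :
    Negligible fun n => ((P.eval n : ℕ) : ℝ) * f n := by
  have := Asymptotics.SuperpolynomialDecay.polynomial_mul hf (P.map (Nat.castRingHom ℝ))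
  refine this.congr fun n => ?_
  simp [Polynomial.eval_natCast_map]

theorem negligible_half_pow : Negligible fun n => (1 / 2 : ℝ) ^ n := fun c =>
  tendsto_pow_const_mul_const_pow_of_abs_lt_one c (by rw [abs_of_pos] <;> norm_num)

end Negligible

section Main

variable {T : Type u} [Fintype T] [DecidableEq T] {K : Type v} {done : T}
  {S p : List T → PMF T} {n i : ℕ} {t : T}

/-! ## The hybrid argument -/

/-- A probability, rounded down to `n` binary digits. -/
def truncate (n : ℕ) (a : ℝ) : ℝ := (⌊2 ^ n * a⌋₊ : ℝ) / 2 ^ n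

theorem abs_sub_truncate_le {a : ℝ} (h : 0 ≤ a) (n : ℕ) :
    |a - truncate n a| ≤ (1 / 2) ^ n := by
  have h1 := Nat.floor_le (mul_nonneg (by positivity : (0 : ℝ) ≤ 2 ^ n) h)
  have h2 := Nat.lt_floor_add_one (2 ^ n * a)
  have h3 : (0 : ℝ) < 2 ^ n := by positivity
  have e : a - truncate n a = (2 ^ n * a - ⌊2 ^ n * a⌋₊) / 2 ^ n := by
    rw [truncate]
    field_simp
  rw [e, abs_of_nonneg (div_nonneg (by linarith) h3.le), one_div, inv_pow, div_le_iff₀ h3,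
    inv_mul_cancel₀ h3.ne']
  linarith

theorem truncate_nonneg (n : ℕ) (a : ℝ) : 0 ≤ truncate n a := by
  unfold truncate; positivity

theorem truncate_le_one {a : ℝ} (h0 : 0 ≤ a) (h : a ≤ 1) (n : ℕ) : truncate n a ≤ 1 := by
  have h3 : (0 : ℝ) < 2 ^ n := by positivity
  rw [truncate, div_le_one h3]
  have := Nat.floor_le (mul_nonneg h3.le h0)
  nlinarith

theorem toReal_pickLaw (c : Bool) (x : List T) :
    (pickLaw done S p n t c x true).toReal = unfinished done x *
      if c then (S x t).toReal else truncate n (p x t).toReal := by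
  unfold pickLaw unfinished
  by_cases hx : x.getLast? = some done
  · simp [hx]
  · simp only [hx, if_false, one_mul]
    cases c
    · simp only [Bool.false_eq_true, if_false]
      refine toReal_bitLaw ?_
      have h3 : (0 : ℝ) ≤ 2 ^ n := by positivity
      have h1 := Nat.floor_le (mul_nonneg h3 (ENNReal.toReal_nonneg (a := p x t)))
      have h2 := toReal_apply_le_one (p x) t
      have : (⌊2 ^ n * (p x t).toReal⌋₊ : ℝ) ≤ (2 ^ n : ℕ) := by
        push_cast
        nlinarith
      exact_mod_cast this
    · simp

omit [Fintype T] [DecidableEq T] in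
theorem toReal_testLaw (L₁ L₂ : List T → PMF Bool) (x : List T) :
    (testLaw L₁ L₂ x true).toReal = (L₁ x true).toReal * (L₂ x true).toReal := by
  rw [testLaw, toReal_bind_apply_fintype]
  simp

/-- Given `x`, the two draws are independent, whence the product; the indicator `unfinished` is
idempotent and so appears once. -/
theorem toReal_distLaw (c₁ c₂ : Bool) :
    (distLaw done S p n i t c₁ c₂ true).toReal = expGen done S (fun x => unfinished done x *
      ((if c₁ then (S x t).toReal else truncate n (p x t).toReal) *
        if c₂ then (S x t).toReal else truncate n (p x t).toReal)) i [] := by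
  rw [distLaw, toReal_generate_bind]
  congr 1
  funext x
  rw [toReal_testLaw, toReal_pickLaw, toReal_pickLaw]
  have : unfinished done x * unfinished done x = unfinished done x := by
    unfold unfinished; split <;> simp
  linear_combination (if c₁ then (S x t).toReal else truncate n (p x t).toReal) *
    (if c₂ then (S x t).toReal else truncate n (p x t).toReal) * this

variable (done S p n i t) in
/-- The deviation of the next token's law `S` from `p`, rounded to `n` digits, on average over
texts with `i` tokens generated from `S`. -/
def deviation (e : ℕ) : ℝ :=
  expGen done S (fun x => (unfinished done x * |(S x t).toReal - truncate n (p x t).toReal|) ^ e) i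
    []

omit [Fintype T] in
theorem deviation_term_le_one (x : List T) :
    unfinished done x * |(S x t).toReal - truncate n (p x t).toReal| ≤ 1 := by
  have h1 := toReal_apply_le_one (S x) t
  have h2 : 0 ≤ (S x t).toReal := ENNReal.toReal_nonneg
  have h3 := truncate_le_one ENNReal.toReal_nonneg (toReal_apply_le_one (p x) t) n
  have h4 := truncate_nonneg n (p x t).toReal
  have h5 : |(S x t).toReal - truncate n (p x t).toReal| ≤ 1 := by
    rw [abs_le]
    constructor <;> linarith
  have h6 := unfinished_le_one (done := done) x
  exact mul_le_one₀ h6 (abs_nonneg _) h5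

omit [Fintype T] in
theorem deviation_term_nonneg (x : List T) :
    0 ≤ unfinished done x * |(S x t).toReal - truncate n (p x t).toReal| :=
  mul_nonneg (unfinished_nonneg x) (abs_nonneg _)

theorem deviation_nonneg (e : ℕ) : 0 ≤ deviation done S p n i t e :=
  expGen_nonneg (fun x => pow_nonneg (deviation_term_nonneg x) _) _ _

theorem deviation_le_one (e : ℕ) : deviation done S p n i t e ≤ 1 := by
  rw [← expGen_const (done := done) (S := S) 1 i []]
  exact expGen_mono (fun x => pow_le_one₀ (deviation_term_nonneg x) (deviation_term_le_one x)) _ _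

/-- Expansion of the square: this is what makes the second moment accessible to distinguishers. -/
theorem deviation_two_eq :
    deviation done S p n i t 2 = (distLaw done S p n i t true true true).toReal -
      2 * (distLaw done S p n i t true false true).toReal +
      (distLaw done S p n i t false false true).toReal := by
  have h : ∀ x, (unfinished done x * |(S x t).toReal - truncate n (p x t).toReal|) ^ 2 =
      unfinished done x * ((S x t).toReal * (S x t).toReal) +
      ((-2) * (unfinished done x * ((S x t).toReal * truncate n (p x t).toReal)) +
      unfinished done x * (truncate n (p x t).toReal * truncate n (p x t).toReal)) := by
    intro x
    rw [mul_pow, sq_abs]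
    have : unfinished done x ^ 2 = unfinished done x := by
      unfold unfinished; split <;> simp
    rw [this]
    ring
  rw [toReal_distLaw, toReal_distLaw, toReal_distLaw, deviation]
  simp only [h, if_true, Bool.false_eq_true, if_false]
  rw [expGen_add, expGen_add, expGen_const_mul]
  ring

/-- Only the rounding error remains. It is at most 2^-n and at most one, and so its square is at
most 2^-n. -/
theorem deviation_self_le : deviation done p p n i t 2 ≤ (1 / 2) ^ n := by
  rw [← expGen_const (done := done) (S := p) ((1 / 2) ^ n) i [], deviation]
  refine expGen_mono (fun x => ?_) _ _
  have h0 := deviation_term_nonneg (done := done) (S := p) (p := p) (n := n) (t := t) x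
  have h1 := deviation_term_le_one (done := done) (S := p) (p := p) (n := n) (t := t) x
  have h2 : unfinished done x * |(p x t).toReal - truncate n (p x t).toReal| ≤ (1 / 2) ^ n := by
    refine (mul_le_of_le_one_left (abs_nonneg _) (unfinished_le_one x)).trans ?_
    exact abs_sub_truncate_le ENNReal.toReal_nonneg n
  nlinarith

theorem l1Dist_generate_le_deviation (k : ℕ) :
    l1Dist (generate done S k []) (generate done p k []) ≤ ∑ i ∈ Finset.range k,
      (∑ t, deviation done S p n i t 1 + Fintype.card T * (1 / 2) ^ n) := by
  refine (l1Dist_generate_le k []).trans (Finset.sum_le_sum fun i _ => ?_)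
  have h : ∀ x, unfinished done x * ∑ t, |(S x t).toReal - (p x t).toReal| ≤
      ∑ t, (unfinished done x * |(S x t).toReal - truncate n (p x t).toReal|) ^ 1 +
        Fintype.card T * (1 / 2) ^ n := by
    intro x
    have e : (Fintype.card T : ℝ) * (1 / 2) ^ n = ∑ _t : T, (1 / 2 : ℝ) ^ n := by simp
    rw [e, ← Finset.sum_add_distrib, Finset.mul_sum]
    refine Finset.sum_le_sum fun t _ => ?_
    rw [pow_one]
    have h1 := abs_sub_le (S x t).toReal (truncate n (p x t).toReal) (p x t).toReal
    have h2 := abs_sub_truncate_le (ENNReal.toReal_nonneg (a := p x t)) n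
    rw [abs_sub_comm] at h2
    have h3 := unfinished_nonneg (done := done) x
    have h4 := unfinished_le_one (done := done) x
    calc _ ≤ unfinished done x * (|(S x t).toReal - truncate n (p x t).toReal| + (1 / 2) ^ n) := by
          gcongr
          linarith
      _ ≤ _ := by
          rw [mul_add]
          gcongr
          exact mul_le_of_le_one_left (by positivity) h4
  refine (expGen_mono h i []).trans ?_
  rw [expGen_add, expGen_sum, expGen_const]
  rfl

/-! ## The attack -/

omit [Fintype T] in
-- With the model's own response as oracle, sampling by queries and sampling from `M.next q` agree
-- at every text that can occur.
theorem distLaw_response {M : LanguageModel T done} {q : Prompt T} {echo : Bool}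
    {f : Prompt T → List T → Prompt T}
    (hf : ∀ (q : Prompt T) (x : List T), done ∉ x →
      ∀ h : ∃ r ∈ {r : List T | x <+: r}, r ∈ (M.response q).support,
        M.response (f q x) =
          ((M.response q).filter {r | x <+: r} h).map
            fun r => if echo then r else r.drop x.length) (c₁ c₂ : Bool) :
    distLaw done (stepLaw done echo f M.response q) (M.next q) n i t c₁ c₂ =
      distLaw done (M.next q) (M.next q) n i t c₁ c₂ := by
  have h := fun i x hx hx' => LanguageModel.stepLaw_response (q := q) (i := i) (x := x) hf hx hx'
  rw [distLaw, distLaw, ← generate_congr (p := M.next q) i fun j y hy hl => (h j y hy hl).symm]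
  refine bind_congr_support fun x hx => ?_
  have : ∀ c, pickLaw done (stepLaw done echo f M.response q) (M.next q) n t c x =
      pickLaw done (M.next q) (M.next q) n t c x := by
    intro c
    unfold pickLaw
    by_cases hl : x.getLast? = some done
    · simp [hl]
    · rw [h i x hx hl]
  simp only [testLaw, this]

/-- The expected deviation for a random key. -/
def keyDeviation (M : LanguageModel T done) (W : WatermarkingScheme T K) (echo : Bool)
    (f : Prompt T → List T → Prompt T) (n : ℕ) (q : Prompt T) (i : ℕ) (t : T) (e : ℕ) : ℝ :=
  expect (W.setup n) fun sk =>
    deviation done (stepLaw done echo f (W.wat n sk) q) (M.next q) n i t e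

variable {M : LanguageModel T done} {W : WatermarkingScheme T K} {echo : Bool}
  {f : Prompt T → List T → Prompt T} {F : PolyTimeProg (Sym T) Empty}

theorem keyDeviation_nonneg (q : Prompt T) (e : ℕ) : 0 ≤ keyDeviation M W echo f n q i t e :=
  expect_nonneg fun _ => deviation_nonneg _

theorem isBounded_deviation {α : Type*} (S : α → List T → PMF T) (e : ℕ) :
    IsBounded fun a => deviation done (S a) p n i t e :=
  IsBounded.of_le_one (fun _ => deviation_nonneg _) fun _ => deviation_le_one _

/-- Jensen's inequality twice, over the key and over the generated text. -/
theorem keyDeviation_one_le (q : Prompt T) :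
    keyDeviation M W echo f n q i t 1 ≤ √(keyDeviation M W echo f n q i t 2) := by
  refine Real.le_sqrt_of_sq_le ((sq_expect_le (isBounded_deviation _ 1)).trans ?_)
  refine expect_mono ?_ (isBounded_deviation _ 2) fun sk => ?_
  · exact IsBounded.of_le_one (fun _ => sq_nonneg _)
      fun _ => pow_le_one₀ (deviation_nonneg 1) (deviation_le_one 1)
  · refine (sq_expGen_le _ _).trans (le_of_eq ?_)
    simp only [pow_one]
    rfl

theorem attackDist_le {A : Attacker T} {n k : ℕ} {q : Prompt T}
    (hA : ∀ w, A.text w n q = generate done (stepLaw done echo f w q) k [])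
    (hk : M.bound.eval q.length ≤ k) :
    attackDist A M W n q ≤ ∑ i ∈ Finset.range k,
      (∑ t, √(keyDeviation M W echo f n q i t 2) + Fintype.card T * (1 / 2) ^ n) := by
  rw [attackDist, statDist_bind_map_pair]
  have h1 : ∀ sk, l1Dist (A.text (W.wat n sk) n q) (M.response q) ≤ ∑ i ∈ Finset.range k,
      (∑ t, deviation done (stepLaw done echo f (W.wat n sk) q) (M.next q) n i t 1 +
        Fintype.card T * (1 / 2) ^ n) := by
    intro sk
    rw [hA, ← LanguageModel.generate_eq_response hk]
    exact l1Dist_generate_le_deviation k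
  have hb : ∀ i ∈ Finset.range k, IsBounded fun sk =>
      (∑ t, deviation done (stepLaw done echo f (W.wat n sk) q) (M.next q) n i t 1 +
        Fintype.card T * (1 / 2 : ℝ) ^ n) := fun i _ =>
    (IsBounded.sum fun t _ => isBounded_deviation _ 1).add (IsBounded.const _)
  have h2 := expect_mono (μ := W.setup n)
    (IsBounded.of_le_one (fun _ => l1Dist_nonneg _ _) fun _ => l1Dist_le_two _ _)
    (IsBounded.sum hb) h1
  have h3 : 0 ≤ expect (W.setup n) fun sk => l1Dist (A.text (W.wat n sk) n q) (M.response q) :=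
    expect_nonneg fun _ => l1Dist_nonneg _ _
  -- The factor 1/2 of the statistical distance is given away.
  refine le_trans (by linarith) (h2.trans ?_)
  rw [expect_sum hb]
  refine Finset.sum_le_sum fun i _ => ?_
  rw [expect_add (IsBounded.sum fun t _ => isBounded_deviation _ 1) (IsBounded.const _),
    expect_const, expect_sum fun t _ => isBounded_deviation _ 1]
  gcongr with t
  exact keyDeviation_one_le q

/-- `UndetectableWith` is applied to three distinguishers, one for each term of the expanded square.
Position and prompt may depend on `n`, as long as `z₀` does not. -/
theorem negligible_keyDeviation
    (hF : ∀ q x, ∀ s ∈ (F.run Empty.elim q (ofTokens x)).support, s.output = f q x)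
    (hf : ∀ (q : Prompt T) (x : List T), done ∉ x →
      ∀ h : ∃ r ∈ {r : List T | x <+: r}, r ∈ (M.response q).support,
        M.response (f q x) =
          ((M.response q).filter {r | x <+: r} h).map
            fun r => if echo then r else r.drop x.length)
    {z₀ : List (Sym T)} {z : ℕ → List (Sym T)} (hW : W.UndetectableWith M z) {i : ℕ → ℕ}
    {q : ℕ → Prompt T} (hz : ∀ n, z₀ ++ z n = encode (i n) (q n)) (t : T) :
    Negligible fun n => keyDeviation M W echo f n (q n) (i n) t 2 := by
  have hD : ∀ c₁ c₂, Negligible fun n =>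
      |(distLaw done (M.next (q n)) (M.next (q n)) n (i n) t c₁ c₂ true).toReal -
        expect (W.setup n) fun sk => (distLaw done (stepLaw done echo f (W.wat n sk) (q n))
          (M.next (q n)) n (i n) t c₁ c₂ true).toReal| := by
    intro c₁ c₂
    obtain ⟨D, hD⟩ := exists_distinguisher (done := done) (echo := echo) hF z₀ t c₁ c₂
    refine Asymptotics.SuperpolynomialDecay.congr (hW D) fun n => ?_
    have h := fun w => hD M.next w n (i n) (q n) (z n) (hz n)
    simp only [h]
    rw [distLaw_response hf, toReal_bind_apply, expect]
  -- The weights 1, 2, 1 are the absolute coefficients in `deviation_two_eq`; the last summand is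
  -- the rounding error without watermark.
  have h := (((hD true true).add ((hD true false).const_mul 2)).add (hD false false)).add
    negligible_half_pow
  refine Negligible.of_le h (fun n => keyDeviation_nonneg _ _) fun n => ?_
  have hb : ∀ c₁ c₂, IsBounded fun sk => (distLaw done (stepLaw done echo f (W.wat n sk) (q n))
      (M.next (q n)) n (i n) t c₁ c₂ true).toReal := fun c₁ c₂ =>
    IsBounded.of_le_one (fun _ => ENNReal.toReal_nonneg) fun _ => toReal_apply_le_one _ _
  have e : keyDeviation M W echo f n (q n) (i n) t 2 =
      expect (W.setup n) fun sk =>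
        (distLaw done (stepLaw done echo f (W.wat n sk) (q n))
          (M.next (q n)) n (i n) t true true true).toReal +
        ((-2) * (distLaw done (stepLaw done echo f (W.wat n sk) (q n))
          (M.next (q n)) n (i n) t true false true).toReal +
        (distLaw done (stepLaw done echo f (W.wat n sk) (q n))
          (M.next (q n)) n (i n) t false false true).toReal) := by
    rw [keyDeviation]
    congr 1
    funext sk
    rw [deviation_two_eq]
    ring
  rw [expect_add (hb _ _) (((hb _ _).const_mul _).add (hb _ _)),
    expect_add ((hb _ _).const_mul _) (hb _ _), expect_const_mul] at e
  have h0 := deviation_self_le (done := done) (p := M.next (q n)) (n := n) (i := i n) (t := t)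
  rw [deviation_two_eq] at h0
  have b1 := neg_abs_le ((distLaw done (M.next (q n)) (M.next (q n)) n (i n) t true true
    true).toReal - expect (W.setup n) fun sk => (distLaw done (stepLaw done echo f (W.wat n sk)
    (q n)) (M.next (q n)) n (i n) t true true true).toReal)
  have b2 := le_abs_self ((distLaw done (M.next (q n)) (M.next (q n)) n (i n) t true false
    true).toReal - expect (W.setup n) fun sk => (distLaw done (stepLaw done echo f (W.wat n sk)
    (q n)) (M.next (q n)) n (i n) t true false true).toReal)
  have b3 := neg_abs_le ((distLaw done (M.next (q n)) (M.next (q n)) n (i n) t false false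
    true).toReal - expect (W.setup n) fun sk => (distLaw done (stepLaw done echo f (W.wat n sk)
    (q n)) (M.next (q n)) n (i n) t false false true).toReal)
  simp only [Pi.add_apply]
  linarith

/-- Brings the model's bound into the form that `polyCounter` computes; `P.eval 1` is the sum of the
coefficients. -/
theorem _root_.Polynomial.eval_le_mul_pow (P : Polynomial ℕ) (m : ℕ) :
    P.eval m ≤ P.eval 1 * (m + 1) ^ P.natDegree := by
  rw [Polynomial.eval_eq_sum_range, Polynomial.eval_eq_sum_range, Finset.sum_mul]
  refine Finset.sum_le_sum fun i hi => ?_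
  rw [one_pow, mul_one]
  exact Nat.mul_le_mul_left _ ((Nat.pow_le_pow_left (Nat.le_succ m) i).trans
    (Nat.pow_le_pow_right (Nat.succ_pos m) (Nat.lt_succ_iff.1 (Finset.mem_range.1 hi))))

end Main

end Watermark

open Watermark in
theorem mainTheorem3 {T : Type*} [Fintype T] [DecidableEq T] {K : Type*} (done : T)
    (M : Watermark.LanguageModel T done) (W : Watermark.WatermarkingScheme T K)
    (echo : Bool) (hM : M.PrefixSpecifiable echo) :
    ∃ A : Watermark.Attacker T,
      -- in every execution, with any text oracle, there is one query per token of output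
      (∀ (w : Watermark.Prompt T → PMF (List T)) (n : ℕ) (q : Watermark.Prompt T),
        ∀ s ∈ (Watermark.Attacker.run A w n q).support,
          s.queries = (Watermark.tokens s.output).length) ∧
      -- uniform distinguishers, fixed prompts
      (W.Undetectable M → ∀ q : Watermark.Prompt T,
        Watermark.Negligible fun n => Watermark.attackDist A M W n q) ∧
      -- non-uniform distinguishers, prompts that vary with the security parameter
      (W.NonuniformlyUndetectable M → ∀ q : ℕ → Watermark.Prompt T, Watermark.PolyLength q →
        Watermark.Negligible fun n => Watermark.attackDist A M W n (q n)) := by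
  obtain ⟨f, F, hF, hf⟩ := hM
  set c := M.bound.eval 1
  set d := M.bound.natDegree
  obtain ⟨A, hA, hA'⟩ := exists_attacker (done := done) echo hF c d
  have hle := fun n (q : Prompt T) => attackDist_le (W := W) (M := M) (echo := echo) (f := f)
    (n := n) (q := q) (fun w => hA' w n q) (M.bound.eval_le_mul_pow q.length)
  have h0 : ∀ n q, 0 ≤ attackDist A M W n q := fun n q => by
    rw [attackDist, statDist]
    exact mul_nonneg (by norm_num) (tsum_nonneg fun _ => abs_nonneg _)
  refine ⟨A, hA, ?_, ?_⟩
  · intro hW q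
    -- For fixed `q` the number of positions is constant, so finitely many negligible terms are
    -- added, without uniformity in `i`.
    refine Negligible.of_le (Negligible.sum fun i _ => ?_) (fun n => h0 n q) fun n => hle n q
    refine Asymptotics.SuperpolynomialDecay.add (Negligible.sum fun t _ => ?_)
      (Asymptotics.SuperpolynomialDecay.const_mul negligible_half_pow _)
    -- Position and prompt are written into the program, and the auxiliary input is empty.
    exact (negligible_keyDeviation hF hf (z₀ := encode i q) (i := fun _ => i) (q := fun _ => q) hW
      (fun n => List.append_nil _) t).sqrt
  · rintro hW q ⟨P, hP⟩
    set k : ℕ → ℕ := fun n => c * ((q n).length + 1) ^ d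
    obtain ⟨Q, hQ⟩ : PolyBounded fun n => c * (P.eval n + 1) ^ d :=
      (PolyBounded.const c).mul (((PolyBounded.eval P).add (PolyBounded.const 1)).pow d)
    have hkQ : ∀ n, k n ≤ Q.eval n := fun n => le_trans (by simp only [k]; gcongr; exact hP n) (hQ n)
    set h : ℕ → ℕ → ℝ := fun n i => ∑ t, √(keyDeviation M W echo f n (q n) i t 2) +
      Fintype.card T * (1 / 2) ^ n
    have hh0 : ∀ n i, 0 ≤ h n i := fun n i =>
      add_nonneg (Finset.sum_nonneg fun t _ => Real.sqrt_nonneg _) (by positivity)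
    -- Now the number of positions grows with `n`, so negligibility at each fixed position would not
    -- suffice. The worst position for each `n` is taken as advice; the default 0 for an empty range
    -- is why only `i ≤ k n` is claimed.
    have hmax : ∀ n, ∃ i, i ≤ k n ∧ ∀ j ∈ Finset.range (k n), h n j ≤ h n i := by
      intro n
      rcases (Finset.range (k n)).eq_empty_or_nonempty with he | hne
      · exact ⟨0, Nat.zero_le _, by simp [he]⟩
      · obtain ⟨i, hi, hmax⟩ := Finset.exists_max_image _ (h n) hne
        exact ⟨i, (Finset.mem_range.1 hi).le, hmax⟩
    choose i hik hi using hmax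
    have hneg : Negligible fun n => h n (i n) := by
      refine Asymptotics.SuperpolynomialDecay.add (Negligible.sum fun t _ => ?_)
        (Asymptotics.SuperpolynomialDecay.const_mul negligible_half_pow _)
      -- The advice consists of the position in unary, one separating bit and the prompt, of length
      -- at most `Q + 1 + P`.
      refine (negligible_keyDeviation hF hf (z₀ := []) (z := fun n => encode (i n) (q n))
        (hW _ ⟨Q + 1 + P, fun n => ?_⟩) (fun n => List.nil_append _) t).sqrt
      have h1 := hik n
      have h2 := hkQ n
      have h3 := hP n
      simp [encode, unary]
      omega
    refine Negligible.of_le (hneg.polynomial_mul Q) (fun n => h0 n _) fun n => ?_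
    -- Polynomially many terms, each at most the one at the worst position.
    refine (hle n (q n)).trans ((Finset.sum_le_card_nsmul _ _ _ (hi n)).trans ?_)
    rw [Finset.card_range, nsmul_eq_mul]
    exact mul_le_mul_of_nonneg_right (by exact_mod_cast hkQ n) (hh0 _ _)

end
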